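/- **Conventions.** A *Lorentzian pre-length space* $(X,d,\ll,\le,\tau)$ is a metric space $(X,d)$ with a preorder $\le$, a transitive relation $\ll$ contained in $\le$, and a lower semicontinuous $\tau:X\times X\to[0,\infty]$ with $\tau(x,z)\ge\tau(x,y)+\tau(y,z)$ for $x\le y\le z$, $\tau(x,y)=0$ if $x\not\le y$, and $\tau(x,y)>0\Leftrightarrow x\ll y$. Spaces are non-empty. Write $x<y$ for $x\le y$, $x\ne y$, and $I^\pm$ for chronological futures and pasts. A *causal* (*timelike*) curve is a non-constant locally Lipschitz map $\gamma$ on an interval such that $\gamma(s)\le\gamma(t)$ ($\gamma(s)\ll\gamma(t)$) whenever $s<t$. Its length on $[a,b]$ is $L_\tau(\gamma)=\inf\sum_i\tau(\gamma(t_i),\gamma(t_{i+1}))$ over all partitions $a=t_0<\dots<t_N=b$; on any other interval it is the supremum of the lengths over compact subintervals. An open set $\Omega\ni x$ is a *localising neighbourhood* of $x$ if (i) the $d$-lengths of the causal curves in $\Omega$ are uniformly bounded; (ii) $I^\pm(y)\cap\Omega\neq\emptyset$ for all $y\in\Omega$, and there is a continuous $\omega:\Omega\times\Omega\to[0,\infty)$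 making $\Omega$, with the restrictions of $d,\ll,\le$, a Lorentzian pre-length space; (iii) any $p<q$ in $\Omega$ are joined by a causal curve $\gamma$ in $\Omega$ that is *maximal in $\Omega$* (at least as long as any causal curve in $\Omega$ with the same endpoints), with $L_\tau(\gamma)=\omega(p,q)\le\tau(p,q)$. The space is a *Lorentzian length space* if every point has a localising neighbourhood; every point has a neighbourhood $U$ such that $\le$ is closed in $\overline U\times\overline U$; any $x\ll y$ (any $x<y$) are joined by a timelike (causal) curve; and $\tau(x,y)$ is the supremum of the lengths of the causal curves from $x$ to $y$ ($0$ if there are none). It is *strongly causal* if the sets $I^+(x)\cap I^-(y)$ form a subbase of the metric topology. A causal curve $\gamma:I\to X$ is a *geodesic* if each $t_0\in I$ has a neighbourhood $[c,d]$ in $I$ such that $\gamma|_{[c,d]}$ is maximal in some localising neighbourhood of $\gamma(t_0)$. *Property (TC)*: every timelike geodesic $\gamma:[a,b)\to X$ or $\gamma:(a,b]\to X$ that does not extend, after any increasing reparametrisation fixing $a$ and $b$, to a geodesic on $[a,b]$ has $L_\tau(\gamma)=\infty$. A Lorentzian length space $(\tilde X,\tilde d,\tilde\ll,\tilde\le,\tilde\tau)$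 is an *extension* of a Lorentzian length space $X$ if $\tilde X$ is connected and there is a distance-preserving map $\iota:X\to\tilde X$ whose image is open and not all of $\tilde X$, which preserves $\le$ and $\ll$, such that a curve $\gamma$ in $X$ is timelike (causal) if and only if $\iota\circ\gamma$ is, and $L_\tau(\gamma)=L_{\tilde\tau}(\iota\circ\gamma)$ for all causal curves $\gamma$ in $X$. If an extension exists, $X$ is *extendible*. Let $M_K$, with time separation $\bar\tau$, be the simply connected two-dimensional Lorentzian model space of constant curvature $K$: the universal cover of de Sitter space of radius $1/\sqrt K$ for $K>0$, the Minkowski plane for $K=0$, the universal cover of anti-de Sitter space of radius $1/\sqrt{-K}$ for $K<0$. A neighbourhood $U$ of a point is a *comparison neighbourhood for the upper (lower) causal curvature bound $K$* if (i) $\tau|_{U\times U}$ is finite and continuous; (ii) any $x<y$ in $U$ are joined by a causal curve in $U$ of length $\tau(x,y)$; (iii) for all $x,y,z\in U$ with $x\ll y\le z$ or $x\le y\ll z$, all sides in $U$ that are causal curves realising $\tau$ (or constant curves, when the endpoints agree), with $a=\tau(x,y)$, $b=\tau(y,z)$, $c=\tau(x,z)$ satisfying $c<\pi/\sqrt K$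 if $K>0$ and $c=a+b$, and $c<\pi/\sqrt{-K}$ if $K<0$; for every triangle $\bar x\le\bar y\le\bar z$ in $M_K$ with the same side lengths; and for all points $p,q$ on the timelike sides (those with timelike related endpoints) with corresponding points $\bar p,\bar q$ (the points on the corresponding geodesic sides with the same time separations from the endpoints), one has $\tau(p,q)\ge\bar\tau(\bar p,\bar q)$ (respectively $\tau(p,q)\le\bar\tau(\bar p,\bar q)$). A space has *causal curvature bounded above by $K$* if every point has a comparison neighbourhood for the upper bound $K$. Its causal curvature is *unbounded above (below)* if some point has, for no $K\in\mathbb R$, a comparison neighbourhood for the upper (lower) bound $K$; it has a *causal curvature singularity* if its causal curvature is unbounded above or below. **Theorem.** Let $X$ be a (non-empty) strongly causal Lorentzian length space with property (TC). If $X$ is extendible, then every Lorentzian length space $\tilde X$ extending $X$ has a causal curvature singularity; specifically, its causal curvature is unbounded above. In particular, for no $K\in\mathbb R$ does $\tilde X$ have causal curvature bounded above by $K$. -/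

import Mathlib

open Set Filter Topology
open scoped ENNReal NNReal

noncomputable section

/-- The data of a Lorentzian pre-length space on a metric space `X`: a preorder `le` (causal
relation), a transitive relation `ll` contained in it (timelike relation), and a lower
semicontinuous time separation function `τ` with values in `[0, ∞]`. -/
structure LorentzianPreLength (X : Type*) [MetricSpace X] where
  le : X → X → Prop
  ll : X → X → Prop
  τ : X → X → ℝ≥0∞
  le_refl : ∀ x, le x x
  le_trans : ∀ x y z, le x y → le y z → le x z
  ll_trans : ∀ x y z, ll x y → ll y z → ll x z
  le_of_ll : ∀ x y, ll x y → le x y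
  lowerSemicontinuous : LowerSemicontinuous (fun p : X × X => τ p.1 p.2)
  reverse_triangle : ∀ x y z, le x y → le y z → τ x y + τ y z ≤ τ x z
  τ_eq_zero : ∀ x y, ¬ le x y → τ x y = 0
  τ_pos_iff : ∀ x y, 0 < τ x y ↔ ll x y

namespace LorentzianPreLength

variable {X : Type*} [MetricSpace X] (L : LorentzianPreLength X)

/-! ### Causal curves and their lengths

A curve on an interval `I ⊆ ℝ` is a map `γ : ℝ → X` together with the order-connected set `I`;
only the values of `γ` on `I` matter. -/

/-- `γ` is a future-directed causal curve on the interval `I`. -/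
def IsCausalCurve (γ : ℝ → X) (I : Set ℝ) : Prop :=
  I.OrdConnected ∧ LocallyLipschitzOn I γ ∧ (∃ s ∈ I, ∃ t ∈ I, γ s ≠ γ t) ∧
    ∀ s ∈ I, ∀ t ∈ I, s < t → L.le (γ s) (γ t)

/-- `γ` is a future-directed timelike curve on the interval `I`. -/
def IsTimelikeCurve (γ : ℝ → X) (I : Set ℝ) : Prop :=
  I.OrdConnected ∧ LocallyLipschitzOn I γ ∧ (∃ s ∈ I, ∃ t ∈ I, γ s ≠ γ t) ∧
    ∀ s ∈ I, ∀ t ∈ I, s < t → L.ll (γ s) (γ t)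

/-- `γ` restricted to `[a, b]` is a future-directed causal curve from `x` to `y`. -/
def IsCausalFromTo (γ : ℝ → X) (a b : ℝ) (x y : X) : Prop :=
  a < b ∧ L.IsCausalCurve γ (Icc a b) ∧ γ a = x ∧ γ b = y

/-- The `τ`-length of `γ` on `[a, b]`: the infimum of `∑ τ (γ (t i)) (γ (t (i + 1)))` over all
partitions `a = t 0 < t 1 < ⋯ < t N = b`. -/
def length (γ : ℝ → X) (a b : ℝ) : ℝ≥0∞ :=
  ⨅ (N : ℕ) (t : ℕ → ℝ) (_ : t 0 = a ∧ t N = b ∧ ∀ i < N, t i < t (i + 1)),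
    ∑ i ∈ Finset.range N, L.τ (γ (t i)) (γ (t (i + 1)))

/-- The `τ`-length of `γ` on an arbitrary interval `I`: the supremum (equivalently, by
monotonicity, the limit) of the lengths over the compact subintervals of `I`. For a causal curve
on `I = [a, b]` this is `length γ a b`. -/
def lengthOn (γ : ℝ → X) (I : Set ℝ) : ℝ≥0∞ :=
  ⨆ (a ∈ I) (b ∈ I) (_ : a ≤ b), L.length γ a b

/-- The supremum of the lengths of causal curves from `x` to `y` (zero if there are none). -/
def supLength (x y : X) : ℝ≥0∞ :=
  ⨆ (γ : ℝ → X) (a : ℝ) (b : ℝ) (_ : L.IsCausalFromTo γ a b x y), L.length γ a b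

/-! ### Causality conditions -/

/-- Strong causality: the Alexandrov topology, which has the sets `I⁺(x) ∩ I⁻(y)` as a subbase,
agrees with the topology of the metric. -/
def StronglyCausal : Prop :=
  (inferInstance : TopologicalSpace X) =
    TopologicalSpace.generateFrom {S : Set X | ∃ x y, S = {z | L.ll x z ∧ L.ll z y}}

def CausallyPathConnected : Prop :=
  (∀ x y, L.ll x y →
    ∃ (γ : ℝ → X) (a b : ℝ), a < b ∧ L.IsTimelikeCurve γ (Icc a b) ∧ γ a = x ∧ γ b = y) ∧
  (∀ x y, L.le x y → x ≠ y → ∃ (γ : ℝ → X) (a b : ℝ), L.IsCausalFromTo γ a b x y)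

/-- Every point has a neighbourhood `U` such that `≤` is closed in `closure U × closure U`. -/
def LocallyCausallyClosed : Prop :=
  ∀ x, ∃ U ∈ 𝓝 x, IsClosed {p : X × X | p.1 ∈ closure U ∧ p.2 ∈ closure U ∧ L.le p.1 p.2}

/-! ### Localising neighbourhoods, Lorentzian length spaces -/

/-- `γ` restricted to `[a, b]` is a causal curve in `Ω` that is at least as long as every causal
curve in `Ω` with the same endpoints. -/
def IsMaximalIn (Ω : Set X) (γ : ℝ → X) (a b : ℝ) : Prop :=
  a < b ∧ L.IsCausalCurve γ (Icc a b) ∧ γ '' Icc a b ⊆ Ω ∧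
    ∀ (σ : ℝ → X) (c d : ℝ), L.IsCausalFromTo σ c d (γ a) (γ b) → σ '' Icc c d ⊆ Ω →
      L.length σ c d ≤ L.length γ a b

/-- `Ω` is a localising neighbourhood of `x`. The local time separation function is the `τ` of
the pre-length structure `ω` on the subspace `Ω`. -/
def IsLocalisingNhd (Ω : Set X) (x : X) : Prop :=
  IsOpen Ω ∧ x ∈ Ω ∧
  -- the `d`-lengths of the causal curves in `Ω` are uniformly bounded
  (∃ C : ℝ≥0, ∀ (γ : ℝ → X) (I : Set ℝ), L.IsCausalCurve γ I → γ '' I ⊆ Ω →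
    eVariationOn γ I ≤ C) ∧
  (∀ y ∈ Ω, (∃ z ∈ Ω, L.ll y z) ∧ (∃ z ∈ Ω, L.ll z y)) ∧
  ∃ ω : LorentzianPreLength Ω,
    (∀ y z : Ω, ω.le y z ↔ L.le y z) ∧ (∀ y z : Ω, ω.ll y z ↔ L.ll y z) ∧
    (∀ y z : Ω, ω.τ y z ≠ ⊤) ∧ Continuous (fun p : Ω × Ω => ω.τ p.1 p.2) ∧
    ∀ p q : Ω, L.le p q → p ≠ q →
      ∃ (γ : ℝ → X) (a b : ℝ), L.IsMaximalIn Ω γ a b ∧ γ a = p ∧ γ b = q ∧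
        L.length γ a b = ω.τ p q ∧ ω.τ p q ≤ L.τ p q

def Localisable : Prop := ∀ x, ∃ Ω, L.IsLocalisingNhd Ω x

/-- Lorentzian length spaces. -/
structure IsLorentzianLengthSpace : Prop where
  locallyCausallyClosed : L.LocallyCausallyClosed
  causallyPathConnected : L.CausallyPathConnected
  localisable : L.Localisable
  τ_eq_supLength : ∀ x y, L.τ x y = L.supLength x y

/-! ### Geodesics and property (TC) -/

/-- A causal curve on `I` is a geodesic if around every parameter it is maximal in some localising
neighbourhood. -/
def IsGeodesic (γ : ℝ → X) (I : Set ℝ) : Prop :=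
  L.IsCausalCurve γ I ∧ ∀ t₀ ∈ I, ∃ Ω, L.IsLocalisingNhd Ω (γ t₀) ∧
    ∃ c ∈ I, ∃ d ∈ I, t₀ ∈ Icc c d ∧ Icc c d ∈ 𝓝[I] t₀ ∧ L.IsMaximalIn Ω γ c d

/-- An increasing homeomorphism of `[a, b]`. -/
def IsReparametrisation (φ : ℝ → ℝ) (a b : ℝ) : Prop :=
  ContinuousOn φ (Icc a b) ∧ StrictMonoOn φ (Icc a b) ∧ φ a = a ∧ φ b = b

/-- The geodesic `γ` on `[a, b)` extends, up to the choice of its parametrisation, to a geodesic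
on `[a, b]`. (Some parametrisations of an extendible geodesic are not Lipschitz at `b`.) -/
def IsFutureExtendible (γ : ℝ → X) (a b : ℝ) : Prop :=
  ∃ (φ : ℝ → ℝ) (σ : ℝ → X), IsReparametrisation φ a b ∧ L.IsGeodesic σ (Icc a b) ∧
    ∀ t ∈ Ico a b, σ t = γ (φ t)

/-- The geodesic `γ` on `(a, b]` extends, up to the choice of its parametrisation, to a geodesic
on `[a, b]`. -/
def IsPastExtendible (γ : ℝ → X) (a b : ℝ) : Prop :=
  ∃ (φ : ℝ → ℝ) (σ : ℝ → X), IsReparametrisation φ a b ∧ L.IsGeodesic σ (Icc a b) ∧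
    ∀ t ∈ Ioc a b, σ t = γ (φ t)

/-- Property (TC): timelike geodesics that are inextendible (to the future or to the past) have
infinite `τ`-length. -/
def PropertyTC : Prop :=
  (∀ (γ : ℝ → X) (a b : ℝ), a < b → L.IsTimelikeCurve γ (Ico a b) → L.IsGeodesic γ (Ico a b) →
    ¬ L.IsFutureExtendible γ a b → L.lengthOn γ (Ico a b) = ⊤) ∧
  (∀ (γ : ℝ → X) (a b : ℝ), a < b → L.IsTimelikeCurve γ (Ioc a b) → L.IsGeodesic γ (Ioc a b) →
    ¬ L.IsPastExtendible γ a b → L.lengthOn γ (Ioc a b) = ⊤)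

/-! ### Extensions -/

/-- The space `(Y, L')` is an extension of `(X, L)` by means of the map `ι`. -/
structure IsExtension {Y : Type*} [MetricSpace Y] (L : LorentzianPreLength X)
    (L' : LorentzianPreLength Y) (ι : X → Y) : Prop where
  connected : ConnectedSpace Y
  isometry : Isometry ι
  isOpen_range : IsOpen (range ι)
  range_ne_univ : range ι ≠ univ
  map_le : ∀ x y, L.le x y → L'.le (ι x) (ι y)
  map_ll : ∀ x y, L.ll x y → L'.ll (ι x) (ι y)
  timelike_iff : ∀ (γ : ℝ → X) (I : Set ℝ), I.OrdConnected →
    (L.IsTimelikeCurve γ I ↔ L'.IsTimelikeCurve (ι ∘ γ) I)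
  causal_iff : ∀ (γ : ℝ → X) (I : Set ℝ), I.OrdConnected →
    (L.IsCausalCurve γ I ↔ L'.IsCausalCurve (ι ∘ γ) I)
  length_eq : ∀ (γ : ℝ → X) (I : Set ℝ), L.IsCausalCurve γ I →
    L.lengthOn γ I = L'.lengthOn (ι ∘ γ) I

end LorentzianPreLength

/-! ### The Lorentzian model surfaces of constant curvature -/

namespace LorentzModel

/-- The simply connected Lorentzian surface `M_K` of constant curvature `K` in global conformal
coordinates (time coordinate first):
* `K = 0`: the plane with `-dt² + dx²`;
* `K > 0`: the strip `|t| < π/2` with `K⁻¹ (cos t)⁻² (-dt² + dx²)`, the universal cover of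
  de Sitter space;
* `K < 0`: the strip `|x| < π/2` with `(-K)⁻¹ (cos x)⁻² (-dt² + dx²)`, the universal cover of
  anti-de Sitter space. -/
def Point (K : ℝ) : Type :=
  {p : ℝ × ℝ // (0 < K → |p.1| < Real.pi / 2) ∧ (K < 0 → |p.2| < Real.pi / 2)}

/-- The causal relation; it is that of the Minkowski plane as the coordinates are conformal. -/
def le {K : ℝ} (p q : Point K) : Prop := |q.1.2 - p.1.2| ≤ q.1.1 - p.1.1

open Classical in
/-- The time separation function of `M_K` (the supremum of the Lorentzian lengths of causal
curves) in closed form. With `r = |K| ^ (-1/2)`, causally related points `p`, `q` satisfy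
`cosh (τ / r) = ⟨P, Q⟩ / r²` if `K > 0` and `cos (τ / r) = -⟨P, Q⟩ / r²` if `K < 0`, where `P`, `Q`
are their images in the quadric in `ℝ³`:
`P = r (tan t, cos x / cos t, sin x / cos t)`, signature `(-,+,+)`, if `K > 0`, and
`P = r (cos t / cos x, sin t / cos x, tan x)`, signature `(-,-,+)`, if `K < 0`.
In the last case the time separation is infinite as soon as a causal curve from `p` to `q` can
touch the boundary of the strip and has conformal time to spare there. -/
def τ {K : ℝ} (p q : Point K) : ℝ≥0∞ :=
  if le p q then
    if 0 < K then
      ENNReal.ofReal (Real.arcosh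
        ((Real.cos (q.1.2 - p.1.2) - Real.sin p.1.1 * Real.sin q.1.1) /
          (Real.cos p.1.1 * Real.cos q.1.1)) / √K)
    else if K < 0 then
      if q.1.1 - p.1.1 ≤ Real.pi - |p.1.2 + q.1.2| then
        ENNReal.ofReal (Real.arccos
          ((Real.cos (q.1.1 - p.1.1) - Real.sin p.1.2 * Real.sin q.1.2) /
            (Real.cos p.1.2 * Real.cos q.1.2)) / √(-K))
      else ⊤
    else ENNReal.ofReal √((q.1.1 - p.1.1) ^ 2 - (q.1.2 - p.1.2) ^ 2)
  else 0

/-- `p` lies on a maximal causal geodesic from `x` to `y`, at time separation `s` from `x` and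
`t` from `y` (where `s + t` is the time separation of `x` and `y`). -/
def IsOnSide {K : ℝ} (x y : Point K) (s t : ℝ≥0∞) (p : Point K) : Prop :=
  le x p ∧ le p y ∧ τ x p = s ∧ τ p y = t ∧ τ x y = s + t

end LorentzModel

/-- Timelike size bounds for `K` on the side lengths `a`, `b`, `c` of a triangle. -/
def TimelikeSizeBounds (K a b c : ℝ) : Prop :=
  0 ≤ a ∧ 0 ≤ b ∧ a + b ≤ c ∧ (c = a + b → 0 < K → c < Real.pi / √K) ∧
    (K < 0 → c < Real.pi / √(-K))

namespace LorentzianPreLength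

variable {X : Type*} [MetricSpace X] (L : LorentzianPreLength X)

/-! ### Causal curvature bounds -/

/-- `S` is the image of a side from `x` to `y` of a triangle in `U`: either `x = y` and the side
is constant, or it is a causal curve in `U` that realises the time separation. -/
def IsSide (U : Set X) (x y : X) (S : Set X) : Prop :=
  (x = y ∧ S = {x}) ∨
    ∃ (γ : ℝ → X) (a b : ℝ), L.IsCausalFromTo γ a b x y ∧ L.length γ a b = L.τ x y ∧
      γ '' Icc a b = S ∧ S ⊆ U

/-- An admissible causal geodesic triangle `(x, y, z)` in `U`, with sides `A` from `x` to `y`,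
`B` from `y` to `z` and `C` from `x` to `z`. -/
structure IsCausalTriangle (U : Set X) (x y z : X) (A B C : Set X) : Prop where
  mem_x : x ∈ U
  mem_y : y ∈ U
  mem_z : z ∈ U
  order : (L.ll x y ∧ L.le y z) ∨ (L.le x y ∧ L.ll y z)
  finite : L.τ x z < ⊤
  side_A : L.IsSide U x y A
  side_B : L.IsSide U y z B
  side_C : L.IsSide U x z C

/-- `(x', y', z')` is a comparison triangle in `M_K` for the triangle `(x, y, z)`. -/
def IsComparisonTriangle {K : ℝ} (x y z : X) (x' y' z' : LorentzModel.Point K) : Prop :=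
  LorentzModel.le x' y' ∧ LorentzModel.le y' z' ∧
    LorentzModel.τ x' y' = L.τ x y ∧ LorentzModel.τ y' z' = L.τ y z ∧
    LorentzModel.τ x' z' = L.τ x z

/-- `p` lies on the side `S` from `x` to `y`, this side is timelike, and `p'` is the corresponding
point on the side from `x'` to `y'` of the comparison triangle. -/
def CorrespondOnSide {K : ℝ} (x y : X) (S : Set X) (x' y' : LorentzModel.Point K) (p : X)
    (p' : LorentzModel.Point K) : Prop :=
  L.ll x y ∧ p ∈ S ∧ LorentzModel.IsOnSide x' y' (L.τ x p) (L.τ p y) p'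

/-- `p` lies on one of the timelike sides of the triangle and `p'` is the corresponding point of
the comparison triangle. -/
def Correspond {K : ℝ} (x y z : X) (A B C : Set X) (x' y' z' : LorentzModel.Point K) (p : X)
    (p' : LorentzModel.Point K) : Prop :=
  L.CorrespondOnSide x y A x' y' p p' ∨ L.CorrespondOnSide y z B y' z' p p' ∨
    L.CorrespondOnSide x z C x' z' p p'

/-- The triangle comparison condition in `U` with respect to `M_K`, where `R s s'` is the required
relation between a time separation `s` in `X` and the corresponding one `s'` in `M_K`. -/
def TriangleComparison (K : ℝ) (R : ℝ≥0∞ → ℝ≥0∞ → Prop) (U : Set X) : Prop :=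
  ∀ (x y z : X) (A B C : Set X), L.IsCausalTriangle U x y z A B C →
    TimelikeSizeBounds K (L.τ x y).toReal (L.τ y z).toReal (L.τ x z).toReal →
    ∀ x' y' z' : LorentzModel.Point K, L.IsComparisonTriangle x y z x' y' z' →
    ∀ (p q : X) (p' q' : LorentzModel.Point K),
      L.Correspond x y z A B C x' y' z' p p' → L.Correspond x y z A B C x' y' z' q q' →
      R (L.τ p q) (LorentzModel.τ p' q')

/-- The neighbourhood `U` of `x` is a comparison neighbourhood with respect to `M_K`, for lower
curvature bounds if `R` is `≤` and for upper curvature bounds if `R` is `≥`. -/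
def IsComparisonNhd (K : ℝ) (R : ℝ≥0∞ → ℝ≥0∞ → Prop) (U : Set X) (x : X) : Prop :=
  U ∈ 𝓝 x ∧
  (∀ y ∈ U, ∀ z ∈ U, L.τ y z < ⊤) ∧ ContinuousOn (fun p : X × X => L.τ p.1 p.2) (U ×ˢ U) ∧
  (∀ y ∈ U, ∀ z ∈ U, L.le y z → y ≠ z → ∃ (γ : ℝ → X) (a b : ℝ),
    L.IsCausalFromTo γ a b y z ∧ γ '' Icc a b ⊆ U ∧ L.length γ a b = L.τ y z) ∧
  L.TriangleComparison K R U

/-- Causal curvature bounded above by `K`. -/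
def CausalCurvatureBoundedAbove (K : ℝ) : Prop :=
  ∀ x, ∃ U, L.IsComparisonNhd K (· ≥ ·) U x

/-- Some point has no comparison neighbourhood for any upper bound `K` on the causal curvature. -/
def CausalCurvatureUnboundedAbove : Prop :=
  ∃ x, ∀ (K : ℝ) (U : Set X), ¬ L.IsComparisonNhd K (· ≥ ·) U x

/-- Some point has no comparison neighbourhood for any lower bound `K` on the causal curvature. -/
def CausalCurvatureUnboundedBelow : Prop :=
  ∃ x, ∀ (K : ℝ) (U : Set X), ¬ L.IsComparisonNhd K (· ≤ ·) U x

/-- The space has a causal curvature singularity: its causal curvature is unbounded, above or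
below, near some point. -/
def HasCausalCurvatureSingularity : Prop :=
  L.CausalCurvatureUnboundedAbove ∨ L.CausalCurvatureUnboundedBelow

end LorentzianPreLength

end

/-! ### Comparison triangles in the model surfaces -/

noncomputable section

namespace LorentzModel

/-! Let `V` be the image of `X` in the extension `Y`. As `Y` is connected and `V` is open and
proper, `V` has a frontier point. Openness of chronological pasts and connection by timelike curves
turn it into a point `p ∉ V` that points of `V` approach chronologically, from the past or from the
future (`exists_timelike_boundary_point`). At this `p` no upper curvature bound can hold.

Otherwise a point `x ≪ p` of `V` close to `p` is joined to `p` by a causal curve realising the time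
separation. Suppose that this curve is timelike. Length is preserved by the embedding, so the part
of the curve before its first exit from `V` pulls back to a timelike geodesic of `X`, maximal and of
finite length. By (TC) it extends within `X`, and uniqueness of limits puts the exit point in `V`, a
contradiction. The case `p ≪ x` is dual.

The curvature bound makes the maximal curve timelike (`IsComparisonNhd.ll_of_null`). Let `y` lie on
a maximal curve from `x` to `z` with `τ x y = 0`, and let `x ≪ q ≪ z`. In the comparison triangle of
`(x, q, z)` the point `y` corresponds to the vertex `x'`, so the upper bound gives `τ y q ≥ τ x' q'
= τ x q > 0`. Letting `q` tend to `x` along a timelike curve, local closedness yields `y ≤ x`, hence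
`y = x`: there is no null initial piece, and dually no null final one. Applied to subsegments, this
excludes null pieces altogether.

Two further facts come from the bounded `d`-lengths in a localising neighbourhood, which forbid
infinite causal zigzags with steps bounded below (`IsLocalisingNhd.not_zigzag`): the causal relation
is antisymmetric there, and the maximal curves above stay close to `p`. -/

theorem le_refl {K : ℝ} (p : Point K) : le p p := by simp [le]

theorem le_trans {K : ℝ} {p q r : Point K} (h₁ : le p q) (h₂ : le q r) : le p r := by
  unfold le at *
  rw [abs_le] at *
  constructor <;> linarith [h₁.1, h₁.2, h₂.1, h₂.2]

theorem τ_self {K : ℝ} (p : Point K) : τ p p = 0 := by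
  unfold τ
  rw [if_pos (le_refl p)]
  split_ifs with hK hK' h
  · have hc : 0 < Real.cos p.1.1 :=
      Real.cos_pos_of_mem_Ioo ⟨(abs_lt.1 (p.2.1 hK)).1, (abs_lt.1 (p.2.1 hK)).2⟩
    have : (Real.cos (p.1.2 - p.1.2) - Real.sin p.1.1 * Real.sin p.1.1) /
        (Real.cos p.1.1 * Real.cos p.1.1) = 1 := by
      rw [div_eq_one_iff_eq (by positivity), sub_self, Real.cos_zero]
      linarith [Real.sin_sq_add_cos_sq p.1.1]
    rw [this]; simp
  · have hc : 0 < Real.cos p.1.2 :=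
      Real.cos_pos_of_mem_Ioo ⟨(abs_lt.1 (p.2.2 hK')).1, (abs_lt.1 (p.2.2 hK')).2⟩
    have : (Real.cos (p.1.1 - p.1.1) - Real.sin p.1.2 * Real.sin p.1.2) /
        (Real.cos p.1.2 * Real.cos p.1.2) = 1 := by
      rw [div_eq_one_iff_eq (by positivity), sub_self, Real.cos_zero]
      linarith [Real.sin_sq_add_cos_sq p.1.2]
    rw [this]; simp
  · have := abs_lt.1 (p.2.2 hK')
    refine absurd ?_ h
    rw [sub_self, sub_nonneg, abs_le]
    constructor <;> linarith
  · simp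

/-- A triangle in the de Sitter strip with prescribed side lengths, in conformal coordinates. -/
theorem exists_deSitter_coordinates {a b c : ℝ} (ha : 0 < a) (hb : 0 < b) (hc : a + b ≤ c) :
    ∃ t u T : ℝ, |t| < Real.pi / 2 ∧ |T| < Real.pi / 2 ∧ |u| ≤ t ∧ |u| ≤ T - t ∧
      Real.cos u / Real.cos t = Real.cosh a ∧
      (Real.cos u - Real.sin t * Real.sin T) / (Real.cos t * Real.cos T) = Real.cosh b ∧
      1 / Real.cos T = Real.cosh c := by
  have hc0 : 0 < c := by linarith
  have hsc : 0 < Real.sinh c := Real.sinh_pos_iff.2 hc0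
  -- The vertices are `(0, 0)`, `(t, u)`, `(T, 0)`, with `tan T = sinh c` and `tan t = m`. The side
  -- `a` forces `cos u = cosh a * cos t`; the side `b` then reads `cosh a * cosh c - m * sinh c =
  -- cosh b`.
  set m := (Real.cosh a * Real.cosh c - Real.cosh b) / Real.sinh c with hm
  have hms : m * Real.sinh c = Real.cosh a * Real.cosh c - Real.cosh b := by
    rw [hm]; field_simp
  have hcT : Real.cos (Real.arctan (Real.sinh c)) = 1 / Real.cosh c := by
    rw [Real.cos_arctan, add_comm, ← Real.cosh_sq, Real.sqrt_sq (Real.cosh_pos c).le]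
  have hsT : Real.sin (Real.arctan (Real.sinh c)) = Real.sinh c / Real.cosh c := by
    rw [Real.sin_arctan, add_comm, ← Real.cosh_sq, Real.sqrt_sq (Real.cosh_pos c).le]
  have hct : 0 < Real.cos (Real.arctan m) := Real.cos_arctan_pos m
  have hst : Real.sin (Real.arctan m) = m * Real.cos (Real.arctan m) := by
    rw [Real.sin_arctan, Real.cos_arctan]; ring
  have h1 : Real.cosh b ≤ Real.cosh (c - a) := by
    rw [Real.cosh_le_cosh, abs_of_pos hb, abs_of_nonneg (by linarith)]; linarith
  have h2 : Real.cosh a ≤ Real.cosh (c - b) := by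
    rw [Real.cosh_le_cosh, abs_of_pos ha, abs_of_nonneg (by linarith)]; linarith
  rw [Real.cosh_sub] at h1 h2
  have hm1 : Real.sinh a ≤ m := by
    rw [hm, le_div_iff₀ hsc]; linarith
  have hsa : 0 < Real.sinh a := Real.sinh_pos_iff.2 ha
  have hm0 : 0 < m := hsa.trans_le hm1
  have hm2 : m ≤ Real.sinh c := by
    refine le_of_mul_le_mul_right ?_ hsc
    rw [hms]
    have e1 := Real.cosh_sq c
    have h3 : Real.sinh (c - b) ≤ Real.sinh c := Real.sinh_le_sinh.2 (by linarith)
    rw [Real.sinh_sub] at h3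
    have h4 := mul_le_mul_of_nonneg_right h2 (Real.cosh_pos c).le
    have h5 := mul_le_mul_of_nonneg_right h3 hsc.le
    have h6 : (Real.cosh c * Real.cosh b - Real.sinh c * Real.sinh b) * Real.cosh c - Real.cosh b =
        (Real.sinh c * Real.cosh b - Real.cosh c * Real.sinh b) * Real.sinh c := by
      linear_combination Real.cosh b * e1
    linarith
  -- This is `sinh a ≤ m` again, and it makes `u` well defined as an arccosine.
  have hcos : Real.cosh a * Real.cos (Real.arctan m) ≤ 1 := by
    rw [Real.cos_arctan, mul_one_div, div_le_one (by positivity)]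
    apply Real.le_sqrt_of_sq_le
    rw [Real.cosh_sq]
    nlinarith
  have hcos0 : 0 < Real.cosh a * Real.cos (Real.arctan m) := mul_pos (Real.cosh_pos a) hct
  have hu : Real.cos (Real.arccos (Real.cosh a * Real.cos (Real.arctan m)))
      = Real.cosh a * Real.cos (Real.arctan m) := Real.cos_arccos (by linarith) hcos
  have ht0 : 0 ≤ Real.arctan m := Real.arctan_nonneg.2 hm0.le
  have htT : Real.arctan m ≤ Real.arctan (Real.sinh c) := Real.arctan_strictMono.monotone hm2
  have hT2 := Real.arctan_lt_pi_div_two (Real.sinh c)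
  have hpi := Real.pi_pos
  refine ⟨Real.arctan m, Real.arccos (Real.cosh a * Real.cos (Real.arctan m)),
    Real.arctan (Real.sinh c), ?_, ?_, ?_, ?_, ?_, ?_, ?_⟩
  · rw [abs_of_nonneg ht0]; exact Real.arctan_lt_pi_div_two m
  · rw [abs_of_nonneg (ht0.trans htT)]; exact hT2
  · rw [abs_of_nonneg (Real.arccos_nonneg _)]
    conv_rhs => rw [← Real.arccos_cos ht0 (by linarith)]
    exact Real.arccos_le_arccos (le_mul_of_one_le_left hct.le (Real.one_le_cosh a))
  · rw [abs_of_nonneg (Real.arccos_nonneg _)]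
    conv_rhs => rw [← Real.arccos_cos (sub_nonneg.2 htT) (by linarith)]
    apply Real.arccos_le_arccos
    rw [Real.cos_sub, hcT, hsT, hst]
    have : 1 / Real.cosh c * Real.cos (Real.arctan m) +
        Real.sinh c / Real.cosh c * (m * Real.cos (Real.arctan m)) =
        ((1 + m * Real.sinh c) / Real.cosh c) * Real.cos (Real.arctan m) := by ring
    rw [this]
    apply mul_le_mul_of_nonneg_right _ hct.le
    rw [div_le_iff₀ (Real.cosh_pos c), hms]
    linarith [Real.one_le_cosh b]
  · rw [hu]; field_simp
  · rw [hu, hsT, hst, hcT]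
    have := Real.cosh_pos c
    field_simp
    linarith
  · rw [hcT]; simp

/-- A triangle in the anti-de Sitter strip with prescribed side lengths, in conformal
coordinates. -/
theorem exists_antiDeSitter_coordinates {a b c : ℝ} (ha : 0 < a) (hb : 0 < b) (hc : a + b ≤ c)
    (hc2 : c < Real.pi / 2) :
    ∃ t u : ℝ, t ≤ Real.pi / 2 ∧ |u| < Real.pi / 2 ∧ |u| ≤ t ∧ |u| ≤ c - t ∧
      Real.cos t / Real.cos u = Real.cos a ∧ Real.cos (c - t) / Real.cos u = Real.cos b := by
  have hpi := Real.pi_pos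
  have hc0 : 0 < c := by linarith
  have hsc : 0 < Real.sin c := Real.sin_pos_of_pos_of_lt_pi hc0 (by linarith)
  have hcc : 0 < Real.cos c := Real.cos_pos_of_mem_Ioo ⟨by linarith, hc2⟩
  have hca : 0 < Real.cos a := Real.cos_pos_of_mem_Ioo ⟨by linarith, by linarith⟩
  have hcb : 0 < Real.cos b := Real.cos_pos_of_mem_Ioo ⟨by linarith, by linarith⟩
  have hsa : 0 < Real.sin a := Real.sin_pos_of_pos_of_lt_pi ha (by linarith)
  have hsb : 0 < Real.sin b := Real.sin_pos_of_pos_of_lt_pi hb (by linarith)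
  -- The vertices are `(0, 0)`, `(t, u)`, `(c, 0)`. Dividing the two required equations gives `cos c
  -- + sin c * tan t = cos b / cos a`, which determines `m = tan t`.
  set m := (Real.cos b / Real.cos a - Real.cos c) / Real.sin c with hm
  have hms : m * Real.sin c = Real.cos b / Real.cos a - Real.cos c := by
    rw [hm]; field_simp
  have hct : 0 < Real.cos (Real.arctan m) := Real.cos_arctan_pos m
  have hst : Real.sin (Real.arctan m) = m * Real.cos (Real.arctan m) := by
    rw [Real.sin_arctan, Real.cos_arctan]; ring
  have h1 : Real.cos (c - a) ≤ Real.cos b :=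
    Real.cos_le_cos_of_nonneg_of_le_pi hb.le (by linarith) (by linarith)
  have h2 : Real.cos (c - b) ≤ Real.cos a :=
    Real.cos_le_cos_of_nonneg_of_le_pi ha.le (by linarith) (by linarith)
  rw [Real.cos_sub] at h1 h2
  have hm1 : Real.tan a ≤ m := by
    rw [hm, le_div_iff₀ hsc, Real.tan_eq_sin_div_cos, le_sub_iff_add_le, le_div_iff₀ hca]
    field_simp
    linarith
  have hm0 : 0 < m := (Real.tan_pos_of_pos_of_lt_pi_div_two ha (by linarith)).trans_le hm1
  have hm2 : m ≤ Real.tan c := by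
    rw [hm, div_le_iff₀ hsc, Real.tan_eq_sin_div_cos, sub_le_iff_le_add, div_le_iff₀ hca]
    have e : (Real.sin c / Real.cos c * Real.sin c + Real.cos c) * Real.cos a
        = Real.cos a / Real.cos c := by
      have := Real.sin_sq_add_cos_sq c
      field_simp
      linarith
    rw [e, le_div_iff₀ hcc]
    have := mul_pos hsc hsb
    linarith
  have hta : a ≤ Real.arctan m := by
    rw [← Real.arctan_tan (x := a) (by linarith) (by linarith)]
    exact Real.arctan_strictMono.monotone hm1
  have htc : Real.arctan m ≤ c := by
    rw [← Real.arctan_tan (x := c) (by linarith) (by linarith)]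
    exact Real.arctan_strictMono.monotone hm2
  have hcos : Real.cos (Real.arctan m) / Real.cos a ≤ 1 := by
    rw [div_le_one hca]
    exact Real.cos_le_cos_of_nonneg_of_le_pi ha.le (by linarith) hta
  have hcos0 : 0 < Real.cos (Real.arctan m) / Real.cos a := div_pos hct hca
  have hu : Real.cos (Real.arccos (Real.cos (Real.arctan m) / Real.cos a))
      = Real.cos (Real.arctan m) / Real.cos a := Real.cos_arccos (by linarith) hcos
  have hct' : Real.cos (c - Real.arctan m) = Real.cos (Real.arctan m) / Real.cos a * Real.cos b := by
    rw [Real.cos_sub, hst]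
    have : Real.cos c * Real.cos (Real.arctan m) + Real.sin c * (m * Real.cos (Real.arctan m))
      = (Real.cos c + m * Real.sin c) * Real.cos (Real.arctan m) := by ring
    rw [this, hms]
    ring
  refine ⟨Real.arctan m, Real.arccos (Real.cos (Real.arctan m) / Real.cos a),
    (Real.arctan_lt_pi_div_two m).le, ?_, ?_, ?_, ?_, ?_⟩
  · rw [abs_of_nonneg (Real.arccos_nonneg _), Real.arccos_lt_pi_div_two]
    exact hcos0
  · rw [abs_of_nonneg (Real.arccos_nonneg _)]
    conv_rhs => rw [← Real.arccos_cos (ha.le.trans hta) (by linarith)]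
    apply Real.arccos_le_arccos
    rw [le_div_iff₀ hca]
    exact mul_le_of_le_one_right hct.le (Real.cos_le_one a)
  · rw [abs_of_nonneg (Real.arccos_nonneg _)]
    conv_rhs => rw [← Real.arccos_cos (sub_nonneg.2 htc) (by linarith)]
    apply Real.arccos_le_arccos
    rw [hct']
    exact mul_le_of_le_one_right hcos0.le (Real.cos_le_one b)
  · rw [hu]; field_simp
  · rw [hu, hct']; field_simp

/-- Realisability of small triangles with timelike sides in the model surfaces. -/
theorem exists_triangle (K : ℝ) : ∃ c₀ : ℝ, 0 < c₀ ∧ ∀ a b c : ℝ, 0 < a → 0 < b → a + b ≤ c →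
    c < c₀ → TimelikeSizeBounds K a b c ∧ ∃ x y z : Point K, le x y ∧ le y z ∧
      τ x y = ENNReal.ofReal a ∧ τ y z = ENNReal.ofReal b ∧ τ x z = ENNReal.ofReal c := by
  have hpi := Real.pi_pos
  rcases lt_trichotomy K 0 with hK | rfl | hK
  · have hr : 0 < √(-K) := Real.sqrt_pos.2 (by linarith)
    -- Half of the size bound suffices and keeps all the cosines positive.
    refine ⟨Real.pi / 2 / √(-K), by positivity, fun a b c ha hb hab hc => ?_⟩
    rw [lt_div_iff₀ hr] at hc
    refine ⟨⟨ha.le, hb.le, hab, fun _ h => absurd h hK.not_gt, fun _ => ?_⟩, ?_⟩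
    · rw [lt_div_iff₀ hr]; linarith
    obtain ⟨t, u, ht, hu, htu, htu', ea, eb⟩ := exists_antiDeSitter_coordinates
      (mul_pos ha hr) (mul_pos hb hr) (by nlinarith : a * √(-K) + b * √(-K) ≤ c * √(-K)) hc
    have hu' := abs_nonneg u
    have hle₁ : le (⟨(0, 0), fun _ => by simp [hpi], fun _ => by simp [hpi]⟩ : Point K)
        ⟨(t, u), fun h => absurd h hK.not_gt, fun _ => hu⟩ := by simpa [le] using htu
    have hle₂ : le (⟨(t, u), fun h => absurd h hK.not_gt, fun _ => hu⟩ : Point K)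
        ⟨(c * √(-K), 0), fun h => absurd h hK.not_gt, fun _ => by simp [hpi]⟩ := by
      simpa [le] using htu'
    have habc : a ≤ c ∧ b ≤ c := ⟨by linarith, by linarith⟩
    have hac := mul_le_mul_of_nonneg_right habc.1 hr.le
    have hbc := mul_le_mul_of_nonneg_right habc.2 hr.le
    have ha' := mul_pos ha hr
    have hb' := mul_pos hb hr
    refine ⟨_, _, _, hle₁, hle₂, ?_, ?_, ?_⟩
    · unfold τ
      rw [if_pos hle₁, if_neg hK.not_gt, if_pos hK, if_pos]
      · simp only [sub_zero, Real.sin_zero, zero_mul, Real.cos_zero, one_mul, ea]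
        rw [Real.arccos_cos ha'.le (by linarith), mul_div_cancel_right₀ _ hr.ne']
      · simp only [sub_zero, zero_add]; linarith
    · unfold τ
      rw [if_pos hle₂, if_neg hK.not_gt, if_pos hK, if_pos]
      · simp only [sub_zero, Real.sin_zero, mul_zero, Real.cos_zero, mul_one, eb]
        rw [Real.arccos_cos hb'.le (by linarith), mul_div_cancel_right₀ _ hr.ne']
      · simp only [add_zero]; linarith
    · unfold τ
      rw [if_pos (le_trans hle₁ hle₂), if_neg hK.not_gt, if_pos hK, if_pos]
      · simp only [sub_zero, Real.sin_zero, mul_zero, Real.cos_zero, mul_one, div_one]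
        rw [Real.arccos_cos (by linarith) (by linarith), mul_div_cancel_right₀ _ hr.ne']
      · simp only [sub_zero, add_zero, abs_zero]; linarith
  · refine ⟨1, one_pos, fun a b c ha hb hab hc => ?_⟩
    refine ⟨⟨ha.le, hb.le, hab, fun _ h => absurd h (lt_irrefl _),
      fun h => absurd h (lt_irrefl _)⟩, ?_⟩
    have hc0 : 0 < c := by linarith
    -- Solves `t ^ 2 - u ^ 2 = a ^ 2` and `(c - t) ^ 2 - u ^ 2 = b ^ 2` for the middle vertex `(t,
    -- u)`.
    set t := (a ^ 2 - b ^ 2 + c ^ 2) / (2 * c) with ht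
    have htc : t * (2 * c) = a ^ 2 - b ^ 2 + c ^ 2 := by rw [ht]; field_simp
    have hta : a ≤ t := by rw [ht, le_div_iff₀ (by positivity)]; nlinarith
    have htb : b ≤ c - t := by
      rw [le_sub_comm, ht, div_le_iff₀ (by positivity)]; nlinarith
    have hu : √(t ^ 2 - a ^ 2) ^ 2 = t ^ 2 - a ^ 2 := Real.sq_sqrt (by nlinarith)
    have hle₁ : le (⟨(0, 0), fun h => absurd h (lt_irrefl _),
        fun h => absurd h (lt_irrefl _)⟩ : Point 0)
        ⟨(t, √(t ^ 2 - a ^ 2)), fun h => absurd h (lt_irrefl _),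
          fun h => absurd h (lt_irrefl _)⟩ := by
      simp only [le, sub_zero, abs_of_nonneg (Real.sqrt_nonneg _)]
      exact Real.sqrt_le_iff.2 ⟨by linarith, by nlinarith⟩
    have hle₂ : le (⟨(t, √(t ^ 2 - a ^ 2)), fun h => absurd h (lt_irrefl _),
          fun h => absurd h (lt_irrefl _)⟩ : Point 0)
        ⟨(c, 0), fun h => absurd h (lt_irrefl _), fun h => absurd h (lt_irrefl _)⟩ := by
      simp only [le, zero_sub, abs_neg, abs_of_nonneg (Real.sqrt_nonneg _)]
      exact Real.sqrt_le_iff.2 ⟨by linarith, by nlinarith⟩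
    refine ⟨_, _, _, hle₁, hle₂, ?_, ?_, ?_⟩
    · unfold τ
      rw [if_pos hle₁, if_neg (lt_irrefl _), if_neg (lt_irrefl _)]
      simp only [sub_zero, hu, sub_sub_cancel, Real.sqrt_sq ha.le]
    · unfold τ
      rw [if_pos hle₂, if_neg (lt_irrefl _), if_neg (lt_irrefl _)]
      simp only [zero_sub, neg_sq, hu]
      rw [show (c - t) ^ 2 - (t ^ 2 - a ^ 2) = b ^ 2 by linear_combination -htc,
        Real.sqrt_sq hb.le]
    · unfold τ
      rw [if_pos (le_trans hle₁ hle₂), if_neg (lt_irrefl _), if_neg (lt_irrefl _)]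
      simp [Real.sqrt_sq hc0.le]
  · have hr : 0 < √K := Real.sqrt_pos.2 hK
    refine ⟨Real.pi / √K, by positivity, fun a b c ha hb hab hc => ?_⟩
    refine ⟨⟨ha.le, hb.le, hab, fun _ _ => hc, fun h => absurd h hK.not_gt⟩, ?_⟩
    obtain ⟨t, u, T, ht, hT, htu, htu', ea, eb, ec⟩ := exists_deSitter_coordinates
      (mul_pos ha hr) (mul_pos hb hr) (by nlinarith : a * √K + b * √K ≤ c * √K)
    have hle₁ : le (⟨(0, 0), fun _ => by simp [hpi], fun _ => by simp [hpi]⟩ : Point K)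
        ⟨(t, u), fun _ => ht, fun h => absurd h hK.not_gt⟩ := by simpa [le] using htu
    have hle₂ : le (⟨(t, u), fun _ => ht, fun h => absurd h hK.not_gt⟩ : Point K)
        ⟨(T, 0), fun _ => hT, fun h => absurd h hK.not_gt⟩ := by
      simpa [le] using htu'
    have hc0 : 0 < c := by linarith
    refine ⟨_, _, _, hle₁, hle₂, ?_, ?_, ?_⟩
    · unfold τ
      rw [if_pos hle₁, if_pos hK]
      simp only [sub_zero, Real.sin_zero, zero_mul, Real.cos_zero, one_mul, ea]
      rw [Real.arcosh_cosh (by positivity), mul_div_cancel_right₀ _ hr.ne']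
    · unfold τ
      rw [if_pos hle₂, if_pos hK]
      simp only [zero_sub, Real.cos_neg, eb]
      rw [Real.arcosh_cosh (by positivity), mul_div_cancel_right₀ _ hr.ne']
    · unfold τ
      rw [if_pos (le_trans hle₁ hle₂), if_pos hK]
      simp only [sub_zero, Real.sin_zero, zero_mul, Real.cos_zero, one_mul, ec]
      rw [Real.arcosh_cosh (by positivity), mul_div_cancel_right₀ _ hr.ne']

end LorentzModel

end

noncomputable section

namespace LorentzianPreLength

variable {X : Type*} [MetricSpace X] (L : LorentzianPreLength X)

/-! ### Monotone and additive curves -/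

/-- `γ` is nondecreasing on `I` with respect to the causal relation. -/
def CausallyMonotoneOn (γ : ℝ → X) (I : Set ℝ) : Prop :=
  ∀ s ∈ I, ∀ t ∈ I, s ≤ t → L.le (γ s) (γ t)

/-- The time separation is additive along `γ` on `I`. -/
def AdditiveOn (γ : ℝ → X) (I : Set ℝ) : Prop :=
  ∀ s ∈ I, ∀ r ∈ I, ∀ t ∈ I, s ≤ r → r ≤ t →
    L.τ (γ s) (γ t) = L.τ (γ s) (γ r) + L.τ (γ r) (γ t)

variable {L}

/-- The reverse triangle inequality at `x ≤ x ≤ x` says `2 τ x x ≤ τ x x`, so the only values are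
`0` and `⊤`. -/
theorem τ_self_eq_zero {x : X} (h : L.τ x x ≠ ⊤) : L.τ x x = 0 := by
  have h1 := L.reverse_triangle x x x (L.le_refl x) (L.le_refl x)
  by_contra h0
  exact absurd h1 (not_le.2 (ENNReal.lt_add_right h h0))

theorem ll_irrefl {x : X} (h : L.τ x x ≠ ⊤) : ¬ L.ll x x := fun hx =>
  ((L.τ_pos_iff x x).2 hx).ne' (τ_self_eq_zero h)

theorem τ_mono {x x' y y' : X} (hx : L.le x x') (hxy : L.le x' y') (hy : L.le y' y) :
    L.τ x' y' ≤ L.τ x y :=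
  calc L.τ x' y' ≤ L.τ x x' + L.τ x' y' := le_add_self
    _ ≤ L.τ x y' := L.reverse_triangle _ _ _ hx hxy
    _ ≤ L.τ x y' + L.τ y' y := le_self_add
    _ ≤ L.τ x y := L.reverse_triangle _ _ _ (L.le_trans _ _ _ hx hxy) hy

theorem ll_of_le_of_ll {x y z : X} (h : L.le x y) (h' : L.ll y z) : L.ll x z := by
  rw [← L.τ_pos_iff] at h' ⊢
  exact h'.trans_le (τ_mono h (L.le_of_ll _ _ ((L.τ_pos_iff _ _).1 h')) (L.le_refl z))

theorem isOpen_chronologicalFuture (x : X) : IsOpen {y | L.ll x y} := by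
  have h : IsOpen {p : X × X | 0 < L.τ p.1 p.2} := by
    have := L.lowerSemicontinuous.isOpen_preimage 0
    exact this
  have := h.preimage (f := fun y : X => (x, y)) (by fun_prop)
  simpa [L.τ_pos_iff] using this

theorem isOpen_chronologicalPast (x : X) : IsOpen {y | L.ll y x} := by
  have h : IsOpen {p : X × X | 0 < L.τ p.1 p.2} := by
    have := L.lowerSemicontinuous.isOpen_preimage 0
    exact this
  have := h.preimage (f := fun y : X => (y, x)) (by fun_prop)
  simpa [L.τ_pos_iff] using this

theorem CausallyMonotoneOn.mono {γ : ℝ → X} {I J : Set ℝ} (h : L.CausallyMonotoneOn γ I)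
    (hJ : J ⊆ I) : L.CausallyMonotoneOn γ J :=
  fun s hs t ht => h s (hJ hs) t (hJ ht)

theorem AdditiveOn.mono {γ : ℝ → X} {I J : Set ℝ} (h : L.AdditiveOn γ I)
    (hJ : J ⊆ I) : L.AdditiveOn γ J :=
  fun s hs r hr t ht => h s (hJ hs) r (hJ hr) t (hJ ht)

theorem IsCausalCurve.causallyMonotoneOn {γ : ℝ → X} {I : Set ℝ} (h : L.IsCausalCurve γ I) :
    L.CausallyMonotoneOn γ I := by
  intro s hs t ht hst
  rcases hst.eq_or_lt with rfl | hst
  · exact L.le_refl _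
  · exact h.2.2.2 s hs t ht hst

/-! ### The length functional -/

theorem length_self (γ : ℝ → X) (a : ℝ) : L.length γ a a = 0 := by
  refine le_antisymm ?_ zero_le
  exact iInf_le_of_le 0 (iInf_le_of_le (fun _ => a) (iInf_le_of_le ⟨rfl, rfl, by simp⟩ (by simp)))

theorem length_le_τ (γ : ℝ → X) {a b : ℝ} (hab : a < b) :
    L.length γ a b ≤ L.τ (γ a) (γ b) := by
  refine iInf_le_of_le 1 (iInf_le_of_le (fun i => if i = 0 then a else b)
    (iInf_le_of_le ⟨by simp, by simp, ?_⟩ (by simp)))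
  intro i hi
  obtain rfl : i = 0 := by omega
  simpa

theorem length_le_two (γ : ℝ → X) {a r b : ℝ} (har : a < r) (hrb : r < b) :
    L.length γ a b ≤ L.τ (γ a) (γ r) + L.τ (γ r) (γ b) := by
  refine iInf_le_of_le 2 (iInf_le_of_le (fun i => if i = 0 then a else if i = 1 then r else b)
    (iInf_le_of_le ⟨by simp, by simp, ?_⟩ (by simp [Finset.sum_range_succ])))
  intro i hi
  interval_cases i <;> simpa

theorem length_le_three (γ : ℝ → X) {a r t b : ℝ} (har : a < r) (hrt : r < t) (htb : t < b) :
    L.length γ a b ≤ L.τ (γ a) (γ r) + L.τ (γ r) (γ t) + L.τ (γ t) (γ b) := by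
  refine iInf_le_of_le 3 (iInf_le_of_le
    (fun i => if i = 0 then a else if i = 1 then r else if i = 2 then t else b)
    (iInf_le_of_le ⟨by simp, by simp, ?_⟩ (by simp [Finset.sum_range_succ])))
  intro i hi
  interval_cases i <;> simpa

theorem lengthOn_le {γ : ℝ → X} {I : Set ℝ} {M : ℝ≥0∞}
    (h : ∀ s ∈ I, ∀ t ∈ I, s ≤ t → L.τ (γ s) (γ t) ≤ M) : L.lengthOn γ I ≤ M := by
  refine iSup₂_le fun s hs => iSup₂_le fun t ht => iSup_le fun hst => ?_
  rcases hst.eq_or_lt with rfl | hlt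
  · rw [length_self]; exact zero_le
  · exact (length_le_τ γ hlt).trans (h s hs t ht hst)

theorem length_le_lengthOn (γ : ℝ → X) {I : Set ℝ} {a b : ℝ} (ha : a ∈ I) (hb : b ∈ I)
    (hab : a ≤ b) : L.length γ a b ≤ L.lengthOn γ I :=
  le_iSup₂_of_le a ha (le_iSup₂_of_le b hb (le_iSup_of_le hab le_rfl))

theorem CausallyMonotoneOn.lengthOn_Icc_le {γ : ℝ → X} {a b : ℝ}
    (h : L.CausallyMonotoneOn γ (Icc a b)) : L.lengthOn γ (Icc a b) ≤ L.τ (γ a) (γ b) := by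
  refine lengthOn_le fun s hs t ht hst => ?_
  have hab : a ≤ b := hs.1.trans hs.2
  exact τ_mono (h a (left_mem_Icc.2 hab) s hs hs.1) (h s hs t ht hst)
    (h t ht b (right_mem_Icc.2 hab) ht.2)

/-- A curve that realises a finite time separation does so on all subintervals. -/
theorem additiveOn_of_length_eq {γ : ℝ → X} {a b : ℝ} (hm : L.CausallyMonotoneOn γ (Icc a b))
    (hfin : L.τ (γ a) (γ b) ≠ ⊤) (hlen : L.length γ a b = L.τ (γ a) (γ b)) :
    L.AdditiveOn γ (Icc a b) := by
  rcases lt_or_ge b a with hba | hab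
  · intro s hs
    exact absurd (hs.1.trans hs.2) hba.not_ge
  have hA := left_mem_Icc.2 hab
  have hB := right_mem_Icc.2 hab
  have hfin' : ∀ s ∈ Icc a b, ∀ t ∈ Icc a b, s ≤ t → L.τ (γ s) (γ t) ≠ ⊤ := fun s hs t ht hst =>
    ne_top_of_le_ne_top hfin (τ_mono (hm a hA s hs hs.1) (hm s hs t ht hst) (hm t ht b hB ht.2))
  have h0 : ∀ s ∈ Icc a b, L.τ (γ s) (γ s) = 0 := fun s hs =>
    τ_self_eq_zero (hfin' s hs s hs le_rfl)
  have h2 : ∀ r ∈ Icc a b, L.τ (γ a) (γ b) = L.τ (γ a) (γ r) + L.τ (γ r) (γ b) := by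
    intro r hr
    refine le_antisymm ?_ (L.reverse_triangle _ _ _ (hm a hA r hr hr.1) (hm r hr b hB hr.2))
    rcases hr.1.eq_or_lt with rfl | h
    · exact le_add_self
    rcases hr.2.eq_or_lt with rfl | h'
    · exact le_self_add
    rw [← hlen]
    exact length_le_two γ h h'
  -- The partition `a < r < t < b` gives the bound; when some of these coincide, it degenerates to
  -- `h2`.
  have h3 : ∀ r ∈ Icc a b, ∀ t ∈ Icc a b, r ≤ t →
      L.τ (γ a) (γ b) ≤ L.τ (γ a) (γ r) + L.τ (γ r) (γ t) + L.τ (γ t) (γ b) := by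
    intro r hr t ht hrt
    rcases hrt.eq_or_lt with rfl | hlt
    · rw [h0 r hr, add_zero, ← h2 r hr]
    rcases hr.1.eq_or_lt with rfl | h
    · rw [h0 _ hr, zero_add, ← h2 t ht]
    rcases ht.2.eq_or_lt with rfl | h'
    · rw [h0 _ ht, add_zero, ← h2 r hr]
    rw [← hlen]
    exact length_le_three γ h hlt h'
  have h4 : ∀ r ∈ Icc a b, ∀ t ∈ Icc a b, r ≤ t →
      L.τ (γ r) (γ b) = L.τ (γ r) (γ t) + L.τ (γ t) (γ b) := by
    intro r hr t ht hrt
    refine le_antisymm ?_ (L.reverse_triangle _ _ _ (hm r hr t ht hrt) (hm t ht b hB ht.2))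
    have := h3 r hr t ht hrt
    rw [h2 r hr, add_assoc] at this
    exact (ENNReal.add_le_add_iff_left (hfin' a hA r hr hr.1)).1 this
  intro s hs r hr t ht hsr hrt
  have e1 := h4 s hs r hr hsr
  rw [h4 r hr t ht hrt, h4 s hs t ht (hsr.trans hrt), ← add_assoc] at e1
  exact (ENNReal.add_left_inj (hfin' t ht b hB ht.2)).1 e1

/-- Sums of an additive interval function over a partition. -/
theorem sum_partition_eq {f : ℝ → ℝ → ℝ≥0∞} {a b : ℝ} (h0 : f a a = 0)
    (hf : ∀ s ∈ Icc a b, ∀ r ∈ Icc a b, ∀ t ∈ Icc a b, s ≤ r → r ≤ t → f s t = f s r + f r t)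
    {N : ℕ} {t : ℕ → ℝ} (ht0 : t 0 = a) (htN : t N = b) (ht : ∀ i < N, t i < t (i + 1)) :
    (∀ i ≤ N, t i ∈ Icc a b) ∧ ∑ i ∈ Finset.range N, f (t i) (t (i + 1)) = f a b := by
  have hge : ∀ i ≤ N, a ≤ t i := by
    intro i
    induction i with
    | zero => intro _; exact ht0.ge
    | succ i ih => intro hi; exact (ih (by omega)).trans (ht i (by omega)).le
  have hle : ∀ j i, i + j = N → t i ≤ b := by
    intro j
    induction j with
    | zero => rintro i rfl; exact htN.le
    | succ j ih => intro i hi; exact (ht i (by omega)).le.trans (ih (i + 1) (by omega))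
  have hmem : ∀ i ≤ N, t i ∈ Icc a b := fun i hi => ⟨hge i hi, hle (N - i) i (by omega)⟩
  refine ⟨hmem, ?_⟩
  have key : ∀ n ≤ N, ∑ i ∈ Finset.range n, f (t i) (t (i + 1)) = f a (t n) := by
    intro n
    induction n with
    | zero => intro _; simp [ht0, h0]
    | succ n ih =>
      intro hn
      have ha : a ∈ Icc a b := by simpa [ht0] using hmem 0 (by omega)
      rw [Finset.sum_range_succ, ih (by omega)]
      exact (hf a ha _ (hmem n (by omega)) _ (hmem (n + 1) hn) (hmem n (by omega)).1
        (ht n (by omega)).le).symm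
  rw [key N le_rfl, htN]

theorem AdditiveOn.length_eq {γ : ℝ → X} {a b : ℝ} (hab : a < b) (h : L.AdditiveOn γ (Icc a b))
    (h0 : L.τ (γ a) (γ a) = 0) : L.length γ a b = L.τ (γ a) (γ b) := by
  refine le_antisymm (length_le_τ γ hab) ?_
  refine le_iInf fun N => le_iInf fun t => le_iInf fun ht => ?_
  exact (sum_partition_eq (f := fun s t => L.τ (γ s) (γ t)) h0 h ht.1 ht.2.1 ht.2.2).2.ge

/-! ### Causal chains in localising neighbourhoods -/

theorem lipschitzOnWith_concat {γ σ : ℝ → X} {a b c d : ℝ} {K K' : ℝ≥0}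
    (hγ : LipschitzOnWith K γ (Icc a b)) (hσ : LipschitzOnWith K' σ (Icc c d))
    (hab : a ≤ b) (hcd : c ≤ d) (h : γ b = σ c) :
    LipschitzOnWith (max K K') (fun t => if t ≤ b then γ t else σ (t - b + c))
      (Icc a (b + (d - c))) := by
  have main : ∀ s ∈ Icc a (b + (d - c)), ∀ t ∈ Icc a (b + (d - c)), s ≤ t →
      dist (if s ≤ b then γ s else σ (s - b + c)) (if t ≤ b then γ t else σ (t - b + c)) ≤
        (max K K' : ℝ≥0) * (t - s) := by
    intro s hs t ht hst
    have hK : (K : ℝ) ≤ (max K K' : ℝ≥0) := by exact_mod_cast le_max_left K K'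
    have hK' : (K' : ℝ) ≤ (max K K' : ℝ≥0) := by exact_mod_cast le_max_right K K'
    split_ifs with h1 h2 h2
    · have := hγ.dist_le_mul s ⟨hs.1, h1⟩ t ⟨ht.1, h2⟩
      rw [Real.dist_eq, abs_sub_comm, abs_of_nonneg (by linarith)] at this
      exact this.trans (mul_le_mul_of_nonneg_right hK (by linarith))
    · have e1 := hγ.dist_le_mul s ⟨hs.1, h1⟩ b ⟨hab, le_rfl⟩
      have e2 := hσ.dist_le_mul c ⟨le_rfl, hcd⟩ (t - b + c) ⟨by linarith, by linarith [ht.2]⟩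
      rw [Real.dist_eq, abs_sub_comm, abs_of_nonneg (by linarith)] at e1 e2
      have e3 := mul_le_mul_of_nonneg_right hK (by linarith : 0 ≤ b - s)
      have e4 := mul_le_mul_of_nonneg_right hK' (by linarith : 0 ≤ t - b + c - c)
      have e5 := dist_triangle (γ s) (γ b) (σ (t - b + c))
      rw [h] at e5 e1
      linarith
    · linarith
    · have := hσ.dist_le_mul (s - b + c) ⟨by linarith, by linarith [hs.2]⟩ (t - b + c)
        ⟨by linarith, by linarith [ht.2]⟩
      rw [Real.dist_eq, abs_sub_comm, abs_of_nonneg (by linarith)] at this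
      have e4 := mul_le_mul_of_nonneg_right hK' (by linarith : 0 ≤ t - b + c - (s - b + c))
      linarith
  refine LipschitzOnWith.of_dist_le_mul fun s hs t ht => ?_
  rcases le_total s t with hst | hst
  · have := main s hs t ht hst
    rwa [Real.dist_eq, abs_sub_comm, abs_of_nonneg (by linarith)]
  · have := main t ht s hs hst
    rwa [dist_comm, Real.dist_eq, abs_of_nonneg (by linarith)]

theorem causallyMonotoneOn_concat {γ σ : ℝ → X} {a b c d : ℝ}
    (hγ : L.CausallyMonotoneOn γ (Icc a b)) (hσ : L.CausallyMonotoneOn σ (Icc c d))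
    (hab : a ≤ b) (hcd : c ≤ d) (h : γ b = σ c) :
    L.CausallyMonotoneOn (fun t => if t ≤ b then γ t else σ (t - b + c))
      (Icc a (b + (d - c))) := by
  intro s hs t ht hst
  dsimp only
  split_ifs with h1 h2 h2
  · exact hγ s ⟨hs.1, h1⟩ t ⟨ht.1, h2⟩ hst
  · refine L.le_trans _ (γ b) _ (hγ s ⟨hs.1, h1⟩ b ⟨hab, le_rfl⟩ h1) ?_
    rw [h]
    exact hσ c ⟨le_rfl, hcd⟩ _ ⟨by linarith, by linarith [ht.2]⟩ (by linarith)
  · linarith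
  · exact hσ _ ⟨by linarith, by linarith [hs.2]⟩ _ ⟨by linarith, by linarith [ht.2]⟩
      (by linarith)

/-- The points of a causal chain in `Ω` lie on a causal curve in `Ω`, if causally related points
of `Ω` are joined by causal curves in `Ω`. -/
theorem exists_curve_through_chain {Ω : Set X}
    (hjoin : ∀ p ∈ Ω, ∀ q ∈ Ω, L.le p q → p ≠ q → ∃ (γ : ℝ → X) (a b : ℝ),
      L.IsCausalFromTo γ a b p q ∧ γ '' Icc a b ⊆ Ω)
    {u : ℕ → X} (hu : ∀ i, u i ∈ Ω) (hle : ∀ i, L.le (u i) (u (i + 1))) (N : ℕ) :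
    ∃ (γ : ℝ → X) (b : ℝ) (K : ℝ≥0), 0 ≤ b ∧ LipschitzOnWith K γ (Icc 0 b) ∧
      L.CausallyMonotoneOn γ (Icc 0 b) ∧ γ '' Icc 0 b ⊆ Ω ∧ γ b = u N ∧
      ∑ i ∈ Finset.range N, edist (u i) (u (i + 1)) ≤ eVariationOn γ (Icc 0 b) := by
  induction N with
  | zero =>
    refine ⟨fun _ => u 0, 0, 0, le_rfl, (LipschitzWith.const _).lipschitzOnWith, fun _ _ _ _ _ => L.le_refl _, ?_,
      rfl, by simp⟩
    rintro _ ⟨t, -, rfl⟩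
    exact hu 0
  | succ N ih =>
    obtain ⟨γ, b, K, hb, hK, hm, him, hγb, hsum⟩ := ih
    -- A repeated point contributes nothing, and causal curves are non-constant, so no piece is
    -- appended.
    by_cases hne : u N = u (N + 1)
    · refine ⟨γ, b, K, hb, hK, hm, him, hγb.trans hne, ?_⟩
      rw [Finset.sum_range_succ, hne, edist_self, add_zero]
      exact hsum
    obtain ⟨σ, c, d, ⟨hcd, hσ, hσc, hσd⟩, hσim⟩ := hjoin _ (hu N) _ (hu (N + 1)) (hle N) hne
    obtain ⟨K', hK'⟩ := hσ.2.1.exists_lipschitzOnWith_of_compact isCompact_Icc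
    have heq : γ b = σ c := hγb.trans hσc.symm
    have hend : (if b + (d - c) ≤ b then γ (b + (d - c)) else σ (b + (d - c) - b + c)) =
        u (N + 1) := by
      rw [if_neg (by linarith), ← hσd]; congr 1; ring
    refine ⟨fun t => if t ≤ b then γ t else σ (t - b + c), b + (d - c), max K K', by linarith,
      lipschitzOnWith_concat hK hK' hb hcd.le heq,
      causallyMonotoneOn_concat hm hσ.causallyMonotoneOn hb hcd.le heq, ?_, hend, ?_⟩
    · rintro _ ⟨t, ht, rfl⟩
      beta_reduce
      split_ifs with h
      · exact him ⟨t, ⟨ht.1, h⟩, rfl⟩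
      · exact hσim ⟨_, ⟨by linarith, by linarith [ht.2]⟩, rfl⟩
    · have := eVariationOn.Icc_add_Icc (fun t => if t ≤ b then γ t else σ (t - b + c))
        (s := univ) hb (by linarith : b ≤ b + (d - c)) (mem_univ b)
      simp only [univ_inter] at this
      rw [Finset.sum_range_succ, ← this]
      refine add_le_add ?_ ?_
      · rw [eVariationOn.eq_of_eqOn (f' := γ) fun t ht => if_pos ht.2]
        exact hsum
      · have h := eVariationOn.edist_le (fun t => if t ≤ b then γ t else σ (t - b + c))
          (s := Icc b (b + (d - c))) (x := b) (y := b + (d - c))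
          ⟨le_rfl, by linarith⟩ ⟨by linarith, le_rfl⟩
        rwa [if_pos le_rfl, hend, hγb] at h

/-- Causal chains in a localising neighbourhood have bounded length with respect to the metric. -/
theorem IsLocalisingNhd.sum_edist_le {Ω : Set X} {x : X} (hΩ : L.IsLocalisingNhd Ω x) :
    ∃ C : ℝ≥0, ∀ u : ℕ → X, (∀ i, u i ∈ Ω) → (∀ i, L.le (u i) (u (i + 1))) →
      ∀ N, ∑ i ∈ Finset.range N, edist (u i) (u (i + 1)) ≤ C := by
  obtain ⟨-, -, ⟨C, hC⟩, -, ω, -, -, -, -, hω⟩ := hΩ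
  refine ⟨C, fun u hu hle N => ?_⟩
  have hjoin : ∀ p ∈ Ω, ∀ q ∈ Ω, L.le p q → p ≠ q → ∃ (γ : ℝ → X) (a b : ℝ),
      L.IsCausalFromTo γ a b p q ∧ γ '' Icc a b ⊆ Ω := by
    intro p hp q hq hpq hne
    obtain ⟨γ, a, b, ⟨hab, hγ, him, -⟩, ha, hb, -⟩ :=
      hω ⟨p, hp⟩ ⟨q, hq⟩ hpq (fun h => hne (congrArg Subtype.val h))
    exact ⟨γ, a, b, ⟨hab, hγ, ha, hb⟩, him⟩
  obtain ⟨γ, b, K, hb, hK, hm, him, -, hsum⟩ := exists_curve_through_chain hjoin hu hle N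
  refine hsum.trans ?_
  -- A constant curve is not causal, so the bound `C` does not cover it, but its variation is zero.
  by_cases hconst : ∃ s ∈ Icc 0 b, ∃ t ∈ Icc 0 b, γ s ≠ γ t
  · refine hC γ (Icc 0 b) ⟨ordConnected_Icc, ?_, hconst, fun s hs t ht hst => hm s hs t ht hst.le⟩
      him
    exact fun s hs => ⟨K, Icc 0 b, self_mem_nhdsWithin, hK⟩
  · push Not at hconst
    rw [eVariationOn.constant_on]
    · exact zero_le
    rintro _ ⟨s, hs, rfl⟩ _ ⟨t, ht, rfl⟩
    exact hconst s hs t ht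

/-- The same bound for future-directed and past-directed chains. -/
theorem IsLocalisingNhd.sum_edist_le' {Ω : Set X} {x : X} (hΩ : L.IsLocalisingNhd Ω x) :
    ∃ C : ℝ≥0, ∀ u : ℕ → X, (∀ i, u i ∈ Ω) →
      ((∀ i, L.le (u i) (u (i + 1))) ∨ (∀ i, L.le (u (i + 1)) (u i))) →
      ∀ N, ∑ i ∈ Finset.range N, edist (u i) (u (i + 1)) ≤ C := by
  obtain ⟨C, hC⟩ := hΩ.sum_edist_le
  refine ⟨C, fun u hu hle N => ?_⟩
  rcases hle with hle | hle
  · exact hC u hu hle N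
  -- The first `N` steps are traversed backwards. Truncated subtraction continues the chain by the
  -- constant `u 0`, so it is causal at every index.
  have h := hC (fun i => u (N - i)) (fun i => hu _) (fun i => ?_) N
  · rw [← Finset.sum_range_reflect]
    refine le_of_eq_of_le (Finset.sum_congr rfl fun i hi => ?_) h
    have hi := Finset.mem_range.1 hi
    rw [edist_comm, show N - 1 - i + 1 = N - i by omega, show N - (i + 1) = N - 1 - i by omega]
  · rcases lt_or_ge i N with hi | hi
    · have := hle (N - (i + 1))
      rwa [show N - (i + 1) + 1 = N - i by omega] at this
    · rw [show N - i = 0 by omega, show N - (i + 1) = 0 by omega]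
      exact L.le_refl _

/-- There is no infinite causal zigzag in a localising neighbourhood with steps bounded below. -/
theorem IsLocalisingNhd.not_zigzag {Ω : Set X} {p : X} (hΩ : L.IsLocalisingNhd Ω p)
    {x y : ℕ → X} (hx : ∀ i, x i ∈ Ω) (hy : ∀ i, y i ∈ Ω)
    (hle : (∀ i, L.le (x i) (y i) ∧ L.le (y i) (x (i + 1))) ∨
      (∀ i, L.le (y i) (x i) ∧ L.le (x (i + 1)) (y i)))
    {ε : ℝ} (hε : 0 < ε) (h : ∀ i, ε ≤ dist (x i) (y i)) : False := by
  obtain ⟨C, hC⟩ := hΩ.sum_edist_le'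
  set u : ℕ → X := fun i => if Even i then x (i / 2) else y (i / 2) with hu
  have hu0 : ∀ i, u (2 * i) = x i := fun i => by simp [hu]
  have hu1 : ∀ i, u (2 * i + 1) = y i := fun i => by
    have : (2 * i + 1) / 2 = i := by omega
    simp [hu, this]
  have hu2 : ∀ i, u (2 * i + 1 + 1) = x (i + 1) := fun i => hu0 (i + 1)
  have huΩ : ∀ i, u i ∈ Ω := fun i => by
    simp only [hu]
    split_ifs
    exacts [hx _, hy _]
  have hule : (∀ i, L.le (u i) (u (i + 1))) ∨ (∀ i, L.le (u (i + 1)) (u i)) := by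
    refine hle.imp (fun hle i => ?_) (fun hle i => ?_) <;>
    · obtain ⟨k, rfl | rfl⟩ := i.even_or_odd'
      · rw [hu0, hu1]; exact (hle k).1
      · rw [hu2, hu1]; exact (hle k).2
  -- In the interleaved chain `x 0, y 0, x 1, y 1, …` every second step has length at least `ε`.
  have key : ∀ N : ℕ, N * ENNReal.ofReal ε ≤
      ∑ i ∈ Finset.range (2 * N), edist (u i) (u (i + 1)) := by
    intro N
    induction N with
    | zero => simp
    | succ N ih =>
      rw [show 2 * (N + 1) = 2 * N + 1 + 1 by ring, Finset.sum_range_succ, Finset.sum_range_succ]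
      push_cast
      rw [add_mul, one_mul]
      refine le_add_right (add_le_add ih ?_)
      rw [edist_dist, hu0, hu1]
      exact ENNReal.ofReal_le_ofReal (h N)
  obtain ⟨N, hN⟩ := exists_nat_gt (C / ε)
  have h1 := (key N).trans (hC u huΩ hule (2 * N))
  rw [div_lt_iff₀ hε] at hN
  have h2 : (C : ℝ≥0∞) = ENNReal.ofReal C := (ENNReal.ofReal_coe_nnreal).symm
  rw [h2, ← ENNReal.ofReal_natCast, ← ENNReal.ofReal_mul (Nat.cast_nonneg N)] at h1
  have := (ENNReal.ofReal_le_ofReal_iff C.2).1 h1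
  exact hN.not_ge this

/-- Distinct points with `x ≤ y ≤ x` could be visited alternately for ever, an infinite zigzag with
steps of length `dist x y`. -/
theorem IsLocalisingNhd.le_antisymm {Ω : Set X} {p x y : X} (hΩ : L.IsLocalisingNhd Ω p)
    (hx : x ∈ Ω) (hy : y ∈ Ω) (hxy : L.le x y) (hyx : L.le y x) : x = y := by
  by_contra hne
  exact hΩ.not_zigzag (fun _ => hx) (fun _ => hy) (Or.inl fun _ => ⟨hxy, hyx⟩)
    (dist_pos.2 hne) (fun _ => le_rfl)

/-- Causal curves that start close to `p` and end in `I⁻(p)` stay close to `p`. -/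
theorem IsLocalisingNhd.eventually_dist_lt_of_le_of_ll {Ω : Set X} {p : X}
    (hΩ : L.IsLocalisingNhd Ω p) {ε : ℝ} (hε : 0 < ε) :
    ∀ᶠ x in 𝓝 p, ∀ y ∈ Ω, L.le x y → L.ll y p → dist y p < ε := by
  by_contra hcon
  have step : ∀ N ∈ 𝓝 p, ∃ z : X × X, z.1 ∈ N ∩ (Ω ∩ Metric.ball p (ε / 2)) ∧ z.2 ∈ Ω ∧
      L.le z.1 z.2 ∧ L.ll z.2 p ∧ ε ≤ dist z.2 p := by
    intro N hN
    have hN' : N ∩ (Ω ∩ Metric.ball p (ε / 2)) ∈ 𝓝 p :=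
      inter_mem hN (inter_mem (hΩ.1.mem_nhds hΩ.2.1) (Metric.ball_mem_nhds p (half_pos hε)))
    by_contra hno
    refine hcon (Filter.mem_of_superset hN' fun x hx y hy hxy hyp => ?_)
    by_contra hd
    exact hno ⟨(x, y), hx, hy, hxy, hyp, not_lt.1 hd⟩
  have : Nonempty (X × X) := ⟨(p, p)⟩
  choose! f hf using step
  -- If the claim fails, there are `x ≤ y ≪ p` with `x` as close to `p` as desired and `y` at
  -- distance at least `ε`. As `I⁺(y)` is a neighbourhood of `p`, the next `x` can be taken in it;
  -- this chains the pairs into a forbidden zigzag with steps of at least `ε / 2`.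
  let z : ℕ → X × X := fun n => Nat.rec (f univ) (fun _ w => f {q | L.ll w.2 q}) n
  have hz : ∀ n, (z n).1 ∈ Ω ∩ Metric.ball p (ε / 2) ∧ (z n).2 ∈ Ω ∧
      L.le (z n).1 (z n).2 ∧ L.ll (z n).2 p ∧ ε ≤ dist (z n).2 p := by
    intro n
    induction n with
    | zero =>
      have := hf univ univ_mem
      exact ⟨this.1.2, this.2⟩
    | succ n ih =>
      have := hf {q | L.ll (z n).2 q} ((isOpen_chronologicalFuture _).mem_nhds ih.2.2.2.1)
      exact ⟨this.1.2, this.2⟩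
  have hz' : ∀ n, L.ll (z n).2 (z (n + 1)).1 := fun n =>
    (hf {q | L.ll (z n).2 q}
      ((isOpen_chronologicalFuture _).mem_nhds (hz n).2.2.2.1)).1.1
  refine hΩ.not_zigzag (x := fun n => (z n).1) (y := fun n => (z n).2) (fun n => (hz n).1.1)
    (fun n => (hz n).2.1) (Or.inl fun n => ⟨(hz n).2.2.1, L.le_of_ll _ _ (hz' n)⟩)
    (half_pos hε) (fun n => ?_)
  have h1 := Metric.mem_ball.1 (hz n).1.2
  have h2 := (hz n).2.2.2.2
  have h3 := dist_triangle_left (z n).2 p (z n).1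
  linarith

/-- Causal curves that end close to `p` and start in `I⁺(p)` stay close to `p`. -/
theorem IsLocalisingNhd.eventually_dist_lt_of_ll_of_le {Ω : Set X} {p : X}
    (hΩ : L.IsLocalisingNhd Ω p) {ε : ℝ} (hε : 0 < ε) :
    ∀ᶠ x in 𝓝 p, ∀ y ∈ Ω, L.ll p y → L.le y x → dist y p < ε := by
  by_contra hcon
  have step : ∀ N ∈ 𝓝 p, ∃ z : X × X, z.1 ∈ N ∩ (Ω ∩ Metric.ball p (ε / 2)) ∧ z.2 ∈ Ω ∧
      L.le z.2 z.1 ∧ L.ll p z.2 ∧ ε ≤ dist z.2 p := by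
    intro N hN
    have hN' : N ∩ (Ω ∩ Metric.ball p (ε / 2)) ∈ 𝓝 p :=
      inter_mem hN (inter_mem (hΩ.1.mem_nhds hΩ.2.1) (Metric.ball_mem_nhds p (half_pos hε)))
    by_contra hno
    refine hcon (Filter.mem_of_superset hN' fun x hx y hy hyp hxy => ?_)
    by_contra hd
    exact hno ⟨(x, y), hx, hy, hxy, hyp, not_lt.1 hd⟩
  have : Nonempty (X × X) := ⟨(p, p)⟩
  choose! f hf using step
  let z : ℕ → X × X := fun n => Nat.rec (f univ) (fun _ w => f {q | L.ll q w.2}) n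
  have hz : ∀ n, (z n).1 ∈ Ω ∩ Metric.ball p (ε / 2) ∧ (z n).2 ∈ Ω ∧
      L.le (z n).2 (z n).1 ∧ L.ll p (z n).2 ∧ ε ≤ dist (z n).2 p := by
    intro n
    induction n with
    | zero =>
      have := hf univ univ_mem
      exact ⟨this.1.2, this.2⟩
    | succ n ih =>
      have := hf {q | L.ll q (z n).2} ((isOpen_chronologicalPast _).mem_nhds ih.2.2.2.1)
      exact ⟨this.1.2, this.2⟩
  have hz' : ∀ n, L.ll (z (n + 1)).1 (z n).2 := fun n =>
    (hf {q | L.ll q (z n).2}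
      ((isOpen_chronologicalPast _).mem_nhds (hz n).2.2.2.1)).1.1
  refine hΩ.not_zigzag (x := fun n => (z n).1) (y := fun n => (z n).2) (fun n => (hz n).1.1)
    (fun n => (hz n).2.1) (Or.inr fun n => ⟨(hz n).2.2.1, L.le_of_ll _ _ (hz' n)⟩)
    (half_pos hε) (fun n => ?_)
  have h1 := Metric.mem_ball.1 (hz n).1.2
  have h2 := (hz n).2.2.2.2
  have h3 := dist_triangle_left (z n).2 p (z n).1
  linarith

end LorentzianPreLength

end

/-! ### Maximal curves under upper curvature bounds -/

noncomputable section

namespace LorentzianPreLength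

variable {X : Type*} [MetricSpace X] {L : LorentzianPreLength X}

theorem IsCausalCurve.mono {γ : ℝ → X} {I J : Set ℝ} (h : L.IsCausalCurve γ I) (hJI : J ⊆ I)
    (hJ : J.OrdConnected) (hne : ∃ s ∈ J, ∃ t ∈ J, γ s ≠ γ t) : L.IsCausalCurve γ J :=
  ⟨hJ, h.2.1.mono hJI, hne, fun s hs t ht => h.2.2.2 s (hJI hs) t (hJI ht)⟩

theorem IsTimelikeCurve.isCausalCurve {γ : ℝ → X} {I : Set ℝ} (h : L.IsTimelikeCurve γ I) :
    L.IsCausalCurve γ I :=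
  ⟨h.1, h.2.1, h.2.2.1, fun s hs t ht hst => L.le_of_ll _ _ (h.2.2.2 s hs t ht hst)⟩

/-! ### Rigidity of maximal curves under upper curvature bounds -/

/-- In a comparison neighbourhood for an upper curvature bound, consider a point `y` on a short
maximal curve from `x` to `z`. If `y` is null related to `x` (to `z`), then every `p` with
`x ≪ p ≪ z` lies in the chronological future (past) of `y`. -/
theorem IsComparisonNhd.ll_of_null {K : ℝ} {U : Set X} {x₀ : X}
    (hU : L.IsComparisonNhd K (· ≥ ·) U x₀) : ∃ c₀ : ℝ, 0 < c₀ ∧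
      ∀ (γ : ℝ → X) (a b : ℝ) (x y z p : X), L.IsCausalFromTo γ a b x z → γ '' Icc a b ⊆ U →
        L.length γ a b = L.τ x z → L.τ x z < ENNReal.ofReal c₀ → p ∈ U → L.ll x p → L.ll p z →
        y ∈ γ '' Icc a b → (L.τ x y = 0 → L.ll y p) ∧ (L.τ y z = 0 → L.ll p y) := by
  obtain ⟨c₀, hc₀, hmodel⟩ := LorentzModel.exists_triangle K
  refine ⟨c₀, hc₀, fun γ a b x y z p hγ him hlen hsmall hp hxp hpz hy => ?_⟩
  obtain ⟨-, hfin, -, hgeo, hcomp⟩ := hU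
  obtain ⟨hab, hγc, rfl, rfl⟩ := id hγ
  have hA : γ a ∈ γ '' Icc a b := ⟨a, left_mem_Icc.2 hab.le, rfl⟩
  have hB : γ b ∈ γ '' Icc a b := ⟨b, right_mem_Icc.2 hab.le, rfl⟩
  have hirr : ∀ q ∈ U, ¬ L.ll q q := fun q hq => ll_irrefl (hfin q hq q hq).ne
  have h0 : ∀ q ∈ U, L.τ q q = 0 := fun q hq => τ_self_eq_zero (hfin q hq q hq).ne
  have hxz : L.ll (γ a) (γ b) := L.ll_trans _ _ _ hxp hpz
  have hadd : L.τ (γ a) (γ b) = L.τ (γ a) y + L.τ y (γ b) := by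
    obtain ⟨s, hs, rfl⟩ := hy
    exact additiveOn_of_length_eq hγc.causallyMonotoneOn (hfin _ (him hA) _ (him hB)).ne hlen
      a (left_mem_Icc.2 hab.le) s hs b (right_mem_Icc.2 hab.le) hs.1 hs.2
  obtain ⟨α, a₁, b₁, hα, hαU, hαlen⟩ := hgeo _ (him hA) p hp (L.le_of_ll _ _ hxp)
    (fun h => hirr p hp (h ▸ hxp))
  obtain ⟨β, a₂, b₂, hβ, hβU, hβlen⟩ := hgeo p hp _ (him hB) (L.le_of_ll _ _ hpz)
    (fun h => hirr p hp (by rw [← h] at hpz; exact hpz))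
  have htri : L.IsCausalTriangle U (γ a) p (γ b) (α '' Icc a₁ b₁) (β '' Icc a₂ b₂)
      (γ '' Icc a b) :=
    { mem_x := him hA
      mem_y := hp
      mem_z := him hB
      order := Or.inl ⟨hxp, L.le_of_ll _ _ hpz⟩
      finite := hfin _ (him hA) _ (him hB)
      side_A := Or.inr ⟨α, a₁, b₁, hα, hαlen, rfl, hαU⟩
      side_B := Or.inr ⟨β, a₂, b₂, hβ, hβlen, rfl, hβU⟩
      side_C := Or.inr ⟨γ, a, b, hγ, hlen, rfl, him⟩ }
  have f1 := (hfin _ (him hA) p hp).ne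
  have f2 := (hfin p hp _ (him hB)).ne
  have f3 := (hfin _ (him hA) _ (him hB)).ne
  have t1 : 0 < L.τ (γ a) p := (L.τ_pos_iff _ _).2 hxp
  have t2 : 0 < L.τ p (γ b) := (L.τ_pos_iff _ _).2 hpz
  have hsum : (L.τ (γ a) p).toReal + (L.τ p (γ b)).toReal ≤ (L.τ (γ a) (γ b)).toReal := by
    rw [← ENNReal.toReal_add f1 f2]
    exact ENNReal.toReal_mono f3
      (L.reverse_triangle _ _ _ (L.le_of_ll _ _ hxp) (L.le_of_ll _ _ hpz))
  obtain ⟨hsize, x', p', z', hxp', hpz', e1, e2, e3⟩ := hmodel _ _ _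
    (ENNReal.toReal_pos t1.ne' f1) (ENNReal.toReal_pos t2.ne' f2) hsum
    ((ENNReal.lt_ofReal_iff_toReal_lt f3).1 hsmall)
  rw [ENNReal.ofReal_toReal f1] at e1
  rw [ENNReal.ofReal_toReal f2] at e2
  rw [ENNReal.ofReal_toReal f3] at e3
  have hcmp := hcomp _ _ _ _ _ _ htri hsize x' p' z' ⟨hxp', hpz', e1, e2, e3⟩
  have hxz' := LorentzModel.le_trans hxp' hpz'
  have hpα : p ∈ α '' Icc a₁ b₁ := ⟨b₁, right_mem_Icc.2 hα.1.le, hα.2.2.2⟩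
  -- The vertex `p` is regarded as the endpoint of the timelike side from `γ a`.
  have hcorr : L.Correspond (γ a) p (γ b) (α '' Icc a₁ b₁) (β '' Icc a₂ b₂) (γ '' Icc a b)
      x' p' z' p p' :=
    Or.inl ⟨hxp, hpα, hxp', LorentzModel.le_refl _, e1, by rw [LorentzModel.τ_self, h0 p hp],
      by rw [e1, h0 p hp, add_zero]⟩
  constructor
  · intro hy0
    rw [hy0, zero_add] at hadd
    -- As `y` has time separation `0` from `γ a` and the full separation from `γ b`, its comparison
    -- point on the long side may be taken to be the vertex `x'`.
    have := hcmp y p x' p' (Or.inr (Or.inr ⟨hxz, hy, LorentzModel.le_refl _, hxz',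
      by rw [LorentzModel.τ_self, hy0], by rw [e3, hadd], by rw [e3, hy0, zero_add, hadd]⟩)) hcorr
    rw [e1] at this
    exact (L.τ_pos_iff _ _).1 (t1.trans_le this)
  · intro hy0
    rw [hy0, add_zero] at hadd
    have := hcmp p y p' z' hcorr (Or.inr (Or.inr ⟨hxz, hy, hxz', LorentzModel.le_refl _,
      by rw [e3, hadd], by rw [LorentzModel.τ_self, hy0], by rw [e3, hy0, add_zero, hadd]⟩))
    rw [e2] at this
    exact (L.τ_pos_iff _ _).1 (t2.trans_le this)

/-- Short maximal curves with timelike related endpoints have no null initial or final pieces near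
the centre of a comparison neighbourhood for an upper curvature bound. -/
theorem IsComparisonNhd.exists_rigid_ball (hL : L.IsLorentzianLengthSpace) {K : ℝ} {U : Set X}
    {x₀ : X} (hU : L.IsComparisonNhd K (· ≥ ·) U x₀) {Ω : Set X} (hΩ : L.IsLocalisingNhd Ω x₀) :
    ∃ c₀ : ℝ, 0 < c₀ ∧ ∃ ε : ℝ, 0 < ε ∧ Metric.closedBall x₀ ε ⊆ Ω ∧
      ∀ (γ : ℝ → X) (a b : ℝ), a < b → L.IsCausalCurve γ (Icc a b) → γ '' Icc a b ⊆ U →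
        L.length γ a b = L.τ (γ a) (γ b) → L.τ (γ a) (γ b) < ENNReal.ofReal c₀ →
        L.ll (γ a) (γ b) → ∀ s ∈ Icc a b, γ s ∈ Metric.closedBall x₀ ε →
        (γ a ∈ Metric.ball x₀ ε → L.τ (γ a) (γ s) = 0 → γ a = γ s) ∧
        (γ b ∈ Metric.ball x₀ ε → L.τ (γ s) (γ b) = 0 → γ s = γ b) := by
  obtain ⟨c₀, hc₀, hnull⟩ := hU.ll_of_null
  obtain ⟨W, hW, hclosed⟩ := hL.locallyCausallyClosed x₀
  -- Rigidity is arranged on a closed ball so that it also applies to points at distance exactly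
  -- `ε`, where a curve would leave the open ball.
  obtain ⟨ε, hε, hball⟩ := Metric.nhds_basis_closedBall.mem_iff.1
    (inter_mem (inter_mem hU.1 hW) (hΩ.1.mem_nhds hΩ.2.1))
  refine ⟨c₀, hc₀, ε, hε, fun x hx => (hball hx).2, ?_⟩
  intro γ a b hab hγ him hlen hsmall hll s hs hsball
  have hm := hγ.causallyMonotoneOn
  have hnhd : ∀ x ∈ Metric.ball x₀ ε, Metric.closedBall x₀ ε ∈ 𝓝 x := fun x hx =>
    mem_of_superset (Metric.isOpen_ball.mem_nhds hx) Metric.ball_subset_closedBall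
  -- The interior points of `σ` lie chronologically between the endpoints of `γ`. They serve as the
  -- middle vertex and converge to either endpoint.
  obtain ⟨σ, c, d, hcd, hσ, hσc, hσd⟩ := hL.causallyPathConnected.1 _ _ hll
  have hσcont := hσ.2.1.continuousOn
  constructor
  · intro ha h0
    refine hΩ.le_antisymm (hball (Metric.ball_subset_closedBall ha)).2 (hball hsball).2
      (hm a (left_mem_Icc.2 hab.le) s hs hs.1) ?_
    have htend : Tendsto σ (𝓝[>] c) (𝓝 (γ a)) := by
      rw [← hσc]
      exact ((hσcont c (left_mem_Icc.2 hcd.le)).mono_of_mem_nhdsWithin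
        (Icc_mem_nhdsGT hcd)).tendsto
    refine (hclosed.mem_of_tendsto (tendsto_const_nhds.prodMk_nhds htend) ?_).2.2
    filter_upwards [htend (hnhd _ ha), Ioo_mem_nhdsGT hcd] with t ht htcd
    have ht' := Ioo_subset_Icc_self htcd
    refine ⟨subset_closure (hball hsball).1.2, subset_closure (hball ht).1.2, L.le_of_ll _ _ ?_⟩
    refine (hnull γ a b _ _ _ _ ⟨hab, hγ, rfl, rfl⟩ him hlen hsmall (hball ht).1.1 ?_ ?_
      ⟨s, hs, rfl⟩).1 h0
    · rw [← hσc]; exact hσ.2.2.2 c (left_mem_Icc.2 hcd.le) t ht' htcd.1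
    · rw [← hσd]; exact hσ.2.2.2 t ht' d (right_mem_Icc.2 hcd.le) htcd.2
  · intro hb h0
    refine hΩ.le_antisymm (hball hsball).2 (hball (Metric.ball_subset_closedBall hb)).2
      (hm s hs b (right_mem_Icc.2 hab.le) hs.2) ?_
    have htend : Tendsto σ (𝓝[<] d) (𝓝 (γ b)) := by
      rw [← hσd]
      exact ((hσcont d (right_mem_Icc.2 hcd.le)).mono_of_mem_nhdsWithin
        (Icc_mem_nhdsLT hcd)).tendsto
    refine (hclosed.mem_of_tendsto (htend.prodMk_nhds tendsto_const_nhds) ?_).2.2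
    filter_upwards [htend (hnhd _ hb), Ioo_mem_nhdsLT hcd] with t ht htcd
    have ht' := Ioo_subset_Icc_self htcd
    refine ⟨subset_closure (hball ht).1.2, subset_closure (hball hsball).1.2, L.le_of_ll _ _ ?_⟩
    refine (hnull γ a b _ _ _ _ ⟨hab, hγ, rfl, rfl⟩ him hlen hsmall (hball ht).1.1 ?_ ?_
      ⟨s, hs, rfl⟩).2 h0
    · rw [← hσc]; exact hσ.2.2.2 c (left_mem_Icc.2 hcd.le) t ht' htcd.1
    · rw [← hσd]; exact hσ.2.2.2 t ht' d (right_mem_Icc.2 hcd.le) htcd.2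

/-- A maximal curve none of whose subsegments has a null initial or final piece is timelike up to
constant pieces. -/
theorem eq_or_ll_of_no_null_ends {γ : ℝ → X} {a b : ℝ} (hγ : L.IsCausalCurve γ (Icc a b))
    (hfin : L.τ (γ a) (γ b) ≠ ⊤) (hadd : L.AdditiveOn γ (Icc a b)) (hll : L.ll (γ a) (γ b))
    (hrigid : ∀ c ∈ Icc a b, ∀ d ∈ Icc a b, c < d → L.IsCausalCurve γ (Icc c d) →
      L.length γ c d = L.τ (γ c) (γ d) → L.ll (γ c) (γ d) → ∀ s ∈ Icc c d,
        (L.τ (γ c) (γ s) = 0 → γ c = γ s) ∧ (L.τ (γ s) (γ d) = 0 → γ s = γ d))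
    {s t : ℝ} (hs : s ∈ Icc a b) (ht : t ∈ Icc a b) (hst : s < t) :
    γ s = γ t ∨ L.ll (γ s) (γ t) := by
  have hab : a ≤ b := hs.1.trans hs.2
  have hA := left_mem_Icc.2 hab
  have hB := right_mem_Icc.2 hab
  have hm := hγ.causallyMonotoneOn
  have hfin' : ∀ r ∈ Icc a b, L.τ (γ r) (γ r) ≠ ⊤ := fun r hr =>
    ne_top_of_le_ne_top hfin (τ_mono (hm a hA r hr hr.1) (L.le_refl _) (hm r hr b hB hr.2))
  have hsub : ∀ c ∈ Icc a b, ∀ d ∈ Icc a b, c < d → L.ll (γ c) (γ d) → ∀ s ∈ Icc c d,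
        (L.τ (γ c) (γ s) = 0 → γ c = γ s) ∧ (L.τ (γ s) (γ d) = 0 → γ s = γ d) := by
    intro c hc d hd hcd hlcd
    have hI : Icc c d ⊆ Icc a b := Icc_subset_Icc hc.1 hd.2
    refine hrigid c hc d hd hcd (hγ.mono hI ordConnected_Icc ⟨c, left_mem_Icc.2 hcd.le, d,
      right_mem_Icc.2 hcd.le, fun h => ll_irrefl (hfin' d hd) (h ▸ hlcd)⟩)
      ((hadd.mono hI).length_eq hcd (τ_self_eq_zero (hfin' c hc))) hlcd
  rw [or_iff_not_imp_right, ← L.τ_pos_iff, not_lt]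
  intro h0
  have h0 := le_antisymm h0 zero_le
  -- A null piece `[s, t]` is a null end of a timelike related segment: the final piece of `[a, t]`
  -- if `τ (γ t) (γ b) = 0`, since then `τ (γ a) (γ t) = τ (γ a) (γ b)`, and otherwise the initial
  -- piece of `[s, b]`.
  by_cases htb : L.τ (γ t) (γ b) = 0
  · have e1 := hadd s hs t ht b hB hst.le ht.2
    have e2 := hadd a hA s hs b hB hs.1 hs.2
    have e3 := hadd a hA s hs t ht hs.1 hst.le
    rw [h0, htb, add_zero] at e1
    rw [e1, add_zero] at e2
    rw [h0, add_zero, ← e2] at e3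
    rw [← L.τ_pos_iff, ← e3, L.τ_pos_iff] at hll
    exact (hsub a hA t ht (hs.1.trans_lt hst) hll s ⟨hs.1, hst.le⟩).2 h0
  · have h1 : L.ll (γ s) (γ b) :=
      ll_of_le_of_ll (hm s hs t ht hst.le) ((L.τ_pos_iff _ _).1 (pos_iff_ne_zero.2 htb))
    exact (hsub s hs b hB (hst.trans_le ht.2) h1 t ⟨hst.le, ht.2⟩).1 h0

/-- A maximal curve from `γ a` to `γ b` that is timelike up to constant pieces. -/
structure IsTimelikeMaximiser (L : LorentzianPreLength X) (γ : ℝ → X) (a b : ℝ) : Prop where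
  lt : a < b
  causal : L.IsCausalCurve γ (Icc a b)
  finite : L.τ (γ a) (γ b) ≠ ⊤
  additive : L.AdditiveOn γ (Icc a b)
  eq_or_ll : ∀ s ∈ Icc a b, ∀ t ∈ Icc a b, s < t → γ s = γ t ∨ L.ll (γ s) (γ t)
  eq_of_eq : ∀ s ∈ Icc a b, ∀ r ∈ Icc a b, ∀ t ∈ Icc a b, s ≤ r → r ≤ t → γ s = γ t → γ r = γ s

/-- Continuity of `τ` at `(p, p)`, where it vanishes. This makes the triangles small enough to be
realised in the model surface. -/
theorem IsComparisonNhd.eventually_τ_lt {K : ℝ} {R : ℝ≥0∞ → ℝ≥0∞ → Prop} {U : Set X} {p : X}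
    (hU : L.IsComparisonNhd K R U p) {c : ℝ} (hc : 0 < c) :
    ∀ᶠ x in 𝓝 p, L.τ x p < ENNReal.ofReal c ∧ L.τ p x < ENNReal.ofReal c := by
  have hp : p ∈ U := mem_of_mem_nhds hU.1
  have hcont : ContinuousAt (fun q : X × X => L.τ q.1 q.2) (p, p) :=
    hU.2.2.1.continuousAt (prod_mem_nhds hU.1 hU.1)
  have h0 : L.τ p p < ENNReal.ofReal c := by
    rw [τ_self_eq_zero (hU.2.1 p hp p hp).ne]
    exact ENNReal.ofReal_pos.2 hc
  have hev := hcont.eventually_lt_const h0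
  have h1 : Tendsto (fun x : X => (x, p)) (𝓝 p) (𝓝 (p, p)) :=
    Continuous.tendsto' (by fun_prop) _ _ rfl
  have h2 : Tendsto (fun x : X => (p, x)) (𝓝 p) (𝓝 (p, p)) :=
    Continuous.tendsto' (by fun_prop) _ _ rfl
  exact (h1.eventually hev).and (h2.eventually hev)

/-- The common part of the construction of timelike maximisers ending or starting at the centre of
a comparison neighbourhood: it suffices to confine the maximal curves to a ball. -/
theorem isTimelikeMaximiser_of_mem_ball {U Ω : Set X} {p : X}
    (hΩ : L.IsLocalisingNhd Ω p) {c₀ ε : ℝ} (hball : Metric.closedBall p ε ⊆ Ω)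
    (hrigid : ∀ (γ : ℝ → X) (a b : ℝ), a < b → L.IsCausalCurve γ (Icc a b) → γ '' Icc a b ⊆ U →
        L.length γ a b = L.τ (γ a) (γ b) → L.τ (γ a) (γ b) < ENNReal.ofReal c₀ →
        L.ll (γ a) (γ b) → ∀ s ∈ Icc a b, γ s ∈ Metric.closedBall p ε →
        (γ a ∈ Metric.ball p ε → L.τ (γ a) (γ s) = 0 → γ a = γ s) ∧
        (γ b ∈ Metric.ball p ε → L.τ (γ s) (γ b) = 0 → γ s = γ b))
    {γ : ℝ → X} {a b : ℝ} (hab : a < b) (hγ : L.IsCausalCurve γ (Icc a b))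
    (him : γ '' Icc a b ⊆ U) (hlen : L.length γ a b = L.τ (γ a) (γ b))
    (hsmall : L.τ (γ a) (γ b) < ENNReal.ofReal c₀) (hll : L.ll (γ a) (γ b))
    (hin : ∀ s ∈ Icc a b, γ s ∈ Metric.ball p ε) : L.IsTimelikeMaximiser γ a b := by
  have hm := hγ.causallyMonotoneOn
  have hfin := (hsmall.trans ENNReal.ofReal_lt_top).ne
  have hadd := additiveOn_of_length_eq hm hfin hlen
  have hinΩ : ∀ s ∈ Icc a b, γ s ∈ Ω := fun s hs =>
    hball (Metric.ball_subset_closedBall (hin s hs))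
  refine ⟨hab, hγ, hfin, hadd, fun s hs t ht hst => ?_, ?_⟩
  · refine eq_or_ll_of_no_null_ends hγ hfin hadd hll ?_ hs ht hst
    intro c hc d hd hcd hcaus hlcd hllcd r hr
    have hI : Icc c d ⊆ Icc a b := Icc_subset_Icc hc.1 hd.2
    have hτ : L.τ (γ c) (γ d) ≤ L.τ (γ a) (γ b) :=
      τ_mono (hm a (left_mem_Icc.2 hab.le) c hc hc.1) (hm c hc d hd hcd.le)
        (hm d hd b (right_mem_Icc.2 hab.le) hd.2)
    have := hrigid γ c d hcd hcaus ((image_mono hI).trans him) hlcd (hτ.trans_lt hsmall) hllcd r hr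
      (Metric.ball_subset_closedBall (hin r (hI hr)))
    exact ⟨this.1 (hin c hc), this.2 (hin d hd)⟩
  · intro s hs r hr t ht hsr hrt hst
    refine hΩ.le_antisymm (hinΩ r hr) (hinΩ s hs) ?_ (hm s hs r hr hsr)
    rw [hst]
    exact hm r hr t ht hrt

/-- The comparison neighbourhood supplies a maximal curve, which might a priori leave the rigid
ball. A point of it on the sphere of radius `ε` would, by rigidity at the endpoint `p`, lie in
`I⁻(p)`; but for `x` close to `p` such points have distance less than `ε` from `p`. -/
theorem IsComparisonNhd.exists_timelikeMaximiser_to (hL : L.IsLorentzianLengthSpace) {K : ℝ}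
    {U : Set X} {p : X} (hU : L.IsComparisonNhd K (· ≥ ·) U p) :
    ∀ᶠ x in 𝓝 p, L.ll x p → ∃ (γ : ℝ → X) (a b : ℝ),
      L.IsTimelikeMaximiser γ a b ∧ γ a = x ∧ γ b = p := by
  obtain ⟨Ω, hΩ⟩ := hL.localisable p
  obtain ⟨c₀, hc₀, ε, hε, hball, hrigid⟩ := hU.exists_rigid_ball hL hΩ
  have hpU : p ∈ U := mem_of_mem_nhds hU.1
  filter_upwards [hU.1, hU.eventually_τ_lt hc₀, hΩ.eventually_dist_lt_of_le_of_ll hε]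
    with x hxU hτ hdist hxp
  have hirr : ¬ L.ll p p := ll_irrefl (hU.2.1 p hpU p hpU).ne
  obtain ⟨γ, a, b, ⟨hab, hγ, rfl, rfl⟩, him, hlen⟩ := hU.2.2.2.1 x hxU p hpU (L.le_of_ll _ _ hxp)
    (fun h => hirr (h ▸ hxp))
  refine ⟨γ, a, b, isTimelikeMaximiser_of_mem_ball hΩ hball hrigid hab hγ him hlen hτ.1 hxp ?_,
    rfl, rfl⟩
  have hm := hγ.causallyMonotoneOn
  intro s hs
  by_contra hout
  rw [Metric.mem_ball, not_lt] at hout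
  have hcont : ContinuousOn (fun t => dist (γ t) (γ b)) (Icc s b) :=
    (continuous_id.dist continuous_const).comp_continuousOn
      (hγ.2.1.continuousOn.mono (Icc_subset_Icc_left hs.1))
  obtain ⟨r, hr, hrε⟩ := intermediate_value_Icc' hs.2 hcont
    (show ε ∈ Icc _ _ by simpa using ⟨hε.le, hout⟩)
  have hr' : r ∈ Icc a b := ⟨hs.1.trans hr.1, hr.2⟩
  have hrball : γ r ∈ Metric.closedBall (γ b) ε := hrε.le
  have hne : γ r ≠ γ b := dist_pos.1 (hε.trans_eq hrε.symm)
  have hrb : L.ll (γ r) (γ b) := by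
    rw [← L.τ_pos_iff, pos_iff_ne_zero]
    exact fun h => hne ((hrigid γ a b hab hγ him hlen hτ.1 hxp r hr' hrball).2
      (Metric.mem_ball_self hε) h)
  exact (hdist (γ r) (hball hrball) (hm a (left_mem_Icc.2 hab.le) r hr' hr'.1) hrb).ne hrε

theorem IsComparisonNhd.exists_timelikeMaximiser_from (hL : L.IsLorentzianLengthSpace) {K : ℝ}
    {U : Set X} {p : X} (hU : L.IsComparisonNhd K (· ≥ ·) U p) :
    ∀ᶠ x in 𝓝 p, L.ll p x → ∃ (γ : ℝ → X) (a b : ℝ),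
      L.IsTimelikeMaximiser γ a b ∧ γ a = p ∧ γ b = x := by
  obtain ⟨Ω, hΩ⟩ := hL.localisable p
  obtain ⟨c₀, hc₀, ε, hε, hball, hrigid⟩ := hU.exists_rigid_ball hL hΩ
  have hpU : p ∈ U := mem_of_mem_nhds hU.1
  filter_upwards [hU.1, hU.eventually_τ_lt hc₀, hΩ.eventually_dist_lt_of_ll_of_le hε]
    with x hxU hτ hdist hpx
  have hirr : ¬ L.ll p p := ll_irrefl (hU.2.1 p hpU p hpU).ne
  obtain ⟨γ, a, b, ⟨hab, hγ, rfl, rfl⟩, him, hlen⟩ := hU.2.2.2.1 p hpU x hxU (L.le_of_ll _ _ hpx)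
    (fun h => hirr (by rw [← h] at hpx; exact hpx))
  refine ⟨γ, a, b, isTimelikeMaximiser_of_mem_ball hΩ hball hrigid hab hγ him hlen hτ.2 hpx ?_,
    rfl, rfl⟩
  have hm := hγ.causallyMonotoneOn
  intro s hs
  by_contra hout
  rw [Metric.mem_ball, not_lt] at hout
  have hcont : ContinuousOn (fun t => dist (γ t) (γ a)) (Icc a s) :=
    (continuous_id.dist continuous_const).comp_continuousOn
      (hγ.2.1.continuousOn.mono (Icc_subset_Icc_right hs.2))
  obtain ⟨r, hr, hrε⟩ := intermediate_value_Icc hs.1 hcont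
    (show ε ∈ Icc _ _ by simpa using ⟨hε.le, hout⟩)
  have hr' : r ∈ Icc a b := ⟨hr.1, hr.2.trans hs.2⟩
  have hrball : γ r ∈ Metric.closedBall (γ a) ε := hrε.le
  have hne : γ r ≠ γ a := dist_pos.1 (hε.trans_eq hrε.symm)
  have har : L.ll (γ a) (γ r) := by
    rw [← L.τ_pos_iff, pos_iff_ne_zero]
    exact fun h => hne ((hrigid γ a b hab hγ him hlen hτ.2 hpx r hr' hrball).1
      (Metric.mem_ball_self hε) h).symm
  exact (hdist (γ r) (hball hrball) har (hm r hr' b (right_mem_Icc.2 hab.le) hr'.2)).ne hrε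

end LorentzianPreLength

end

/-! ### Arc length, pullback to the original space, and boundary points -/

noncomputable section

namespace LorentzianPreLength

variable {X Y : Type*} [MetricSpace X] [MetricSpace Y] {L : LorentzianPreLength X}
  {L' : LorentzianPreLength Y} {ι : X → Y}

/-- Parametrised by arc length, a timelike maximiser is a timelike curve. -/
theorem IsTimelikeMaximiser.exists_timelikeCurve {γ : ℝ → X} {a b : ℝ}
    (h : L.IsTimelikeMaximiser γ a b) : ∃ (σ : ℝ → X) (ℓ : ℝ), 0 < ℓ ∧
      L.IsTimelikeCurve σ (Icc 0 ℓ) ∧ L.AdditiveOn σ (Icc 0 ℓ) ∧ σ 0 = γ a ∧ σ ℓ = γ b := by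
  obtain ⟨hab, hγ, hfin, hadd, hll, heq⟩ := h
  have hA := left_mem_Icc.2 hab.le
  have hB := right_mem_Icc.2 hab.le
  obtain ⟨K, hK⟩ := hγ.2.1.exists_lipschitzOnWith_of_compact isCompact_Icc
  have hbv := hK.locallyBoundedVariationOn
  set f := variationOnFromTo γ (Icc a b) a with hf
  have hmono : MonotoneOn f (Icc a b) := variationOnFromTo.monotoneOn hbv hA
  have hdiff : ∀ s ∈ Icc a b, ∀ t ∈ Icc a b, s ≤ t →
      eVariationOn γ (Icc a b ∩ Icc s t) = ENNReal.ofReal (f t - f s) := by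
    intro s hs t ht hst
    have : f t - f s = variationOnFromTo γ (Icc a b) s t := by
      rw [hf, ← variationOnFromTo.add hbv hA hs ht]; ring
    rw [this, variationOnFromTo.eq_of_le γ _ hst, ENNReal.ofReal_toReal (hbv s t hs ht)]
  have hlip : ∀ s ∈ Icc a b, ∀ t ∈ Icc a b, s ≤ t → f t - f s ≤ K * (t - s) := by
    intro s hs t ht hst
    have h1 := hK.comp_eVariationOn_le (g := id) (s := Icc a b ∩ Icc s t) (fun x hx => hx.1)
    have h2 := ((monotoneOn_id (s := Icc a b)).eVariationOn_eq hs ht).le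
    rw [Function.comp_id, hdiff s hs t ht hst] at h1
    have h3 := h1.trans (mul_le_mul_right h2 _)
    rw [← ENNReal.ofReal_coe_nnreal, ← ENNReal.ofReal_mul K.coe_nonneg] at h3
    exact (ENNReal.ofReal_le_ofReal_iff (mul_nonneg K.coe_nonneg (sub_nonneg.2 hst))).1 h3
  have hcont : ContinuousOn f (Icc a b) := by
    have : LipschitzOnWith K f (Icc a b) := by
      refine LipschitzOnWith.of_le_add_mul K fun s hs t ht => ?_
      rcases le_total s t with hst | hst
      · exact le_add_of_le_of_nonneg (hmono hs ht hst) (mul_nonneg K.coe_nonneg dist_nonneg)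
      · rw [Real.dist_eq, abs_of_nonneg (sub_nonneg.2 hst)]
        linarith [hlip t ht s hs hst]
    exact this.continuousOn
  have hfa : f a = 0 := variationOnFromTo.self γ _ a
  have hsurj : ∀ u ∈ Icc 0 (f b), ∃ t ∈ Icc a b, f t = u := by
    intro u hu
    rw [← hfa] at hu
    exact intermediate_value_Icc hab.le hcont hu
  -- An arbitrary right inverse of the arc length `f` will do: parameters with equal `f` have equal
  -- images under `γ`, and `γ ∘ h` skips the constant pieces.
  choose! h hh hfh using hsurj
  have hstrict : ∀ u ∈ Icc 0 (f b), ∀ v ∈ Icc 0 (f b), u < v → h u < h v := by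
    intro u hu v hv huv
    by_contra hcon
    have := hmono (hh v hv) (hh u hu) (not_lt.1 hcon)
    rw [hfh u hu, hfh v hv] at this
    linarith
  have hle : ∀ u ∈ Icc 0 (f b), ∀ v ∈ Icc 0 (f b), u ≤ v → h u ≤ h v := by
    intro u hu v hv huv
    rcases huv.eq_or_lt with rfl | huv
    · exact le_rfl
    · exact (hstrict u hu v hv huv).le
  have hedist : ∀ s ∈ Icc a b, ∀ t ∈ Icc a b, s ≤ t → dist (γ s) (γ t) ≤ f t - f s := by
    intro s hs t ht hst
    have := eVariationOn.edist_le γ (s := Icc a b ∩ Icc s t) ⟨hs, left_mem_Icc.2 hst⟩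
      ⟨ht, right_mem_Icc.2 hst⟩
    rw [hdiff s hs t ht hst, edist_dist] at this
    exact (ENNReal.ofReal_le_ofReal_iff (sub_nonneg.2 (hmono hs ht hst))).1 this
  have hval : ∀ t ∈ Icc a b, f t ∈ Icc 0 (f b) → γ (h (f t)) = γ t := by
    intro t ht hft
    rcases le_total (h (f t)) t with hle | hle
    · have := hedist _ (hh _ hft) t ht hle
      rw [hfh _ hft, sub_self] at this
      exact dist_le_zero.1 this
    · have := hedist t ht _ (hh _ hft) hle
      rw [hfh _ hft, sub_self] at this
      exact (dist_le_zero.1 this).symm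
  have hℓ : 0 < f b := by
    obtain ⟨s, hs, t, ht, hst⟩ := hγ.2.2.1
    wlog hle : s ≤ t generalizing s t
    · exact this t ht s hs hst.symm (le_of_not_ge hle)
    have h1 := hedist s hs t ht hle
    have h2 := dist_pos.2 hst
    have h3 := hmono hA hs hs.1
    have h4 := hmono ht hB ht.2
    linarith
  have h0mem : (0 : ℝ) ∈ Icc 0 (f b) := left_mem_Icc.2 hℓ.le
  have hℓmem : f b ∈ Icc 0 (f b) := right_mem_Icc.2 hℓ.le
  have hends : γ (h 0) = γ a ∧ γ (h (f b)) = γ b := by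
    refine ⟨?_, hval b hB hℓmem⟩
    have := hval a hA (by rw [hfa]; exact h0mem)
    rwa [hfa] at this
  have htime : ∀ u ∈ Icc 0 (f b), ∀ v ∈ Icc 0 (f b), u < v → L.ll (γ (h u)) (γ (h v)) := by
    intro u hu v hv huv
    -- Equal values at `h u < h v` would make `γ` constant in between, so that the arc length `v -
    -- u` would vanish.
    refine (hll _ (hh u hu) _ (hh v hv) (hstrict u hu v hv huv)).resolve_left fun hcon => ?_
    have h1 := hdiff _ (hh u hu) _ (hh v hv) (hstrict u hu v hv huv).le
    rw [hfh u hu, hfh v hv, eVariationOn.constant_on] at h1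
    · have := ENNReal.ofReal_pos.2 (sub_pos.2 huv)
      rw [← h1] at this
      exact lt_irrefl _ this
    · rintro _ ⟨s, hs, rfl⟩ _ ⟨t, ht, rfl⟩
      rw [heq _ (hh u hu) s hs.1 _ (hh v hv) hs.2.1 hs.2.2 hcon,
        heq _ (hh u hu) t ht.1 _ (hh v hv) ht.2.1 ht.2.2 hcon]
  have hlipσ : LipschitzOnWith 1 (fun u => γ (h u)) (Icc 0 (f b)) := by
    refine LipschitzOnWith.of_dist_le_mul fun u hu v hv => ?_
    rw [NNReal.coe_one, one_mul]
    rcases le_total u v with huv | huv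
    · have := hedist _ (hh u hu) _ (hh v hv) (hle u hu v hv huv)
      rw [hfh u hu, hfh v hv] at this
      rwa [Real.dist_eq, abs_sub_comm, abs_of_nonneg (sub_nonneg.2 huv)]
    · have := hedist _ (hh v hv) _ (hh u hu) (hle v hv u hu huv)
      rw [hfh u hu, hfh v hv] at this
      rwa [dist_comm, Real.dist_eq, abs_of_nonneg (sub_nonneg.2 huv)]
  refine ⟨fun u => γ (h u), f b, hℓ, ⟨ordConnected_Icc,
    fun s _ => ⟨1, Icc 0 (f b), self_mem_nhdsWithin, hlipσ⟩, ⟨0, h0mem, f b, hℓmem, ?_⟩, htime⟩,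
    ?_, hends.1, hends.2⟩
  · intro hcon
    have h1 := htime 0 h0mem _ hℓmem hℓ
    dsimp only at hcon
    rw [hends.1, hends.2] at h1 hcon
    rw [hcon] at h1 hfin
    exact ll_irrefl hfin h1
  · intro u hu v hv w hw huv hvw
    exact hadd _ (hh u hu) _ (hh v hv) _ (hh w hw) (hle u hu v hv huv) (hle v hv w hw hvw)

/-! ### Pulling back maximal timelike curves from an extension -/

/-- A causal curve in `X` along which the time separation of the extension is additive is maximal
among all causal curves of `X` with the same endpoints. -/
theorem IsExtension.length_le_of_additiveOn (hext : IsExtension L L' ι) {g σ : ℝ → X}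
    {a b c d : ℝ} (hab : a < b) (hg : L.IsCausalCurve g (Icc a b))
    (hne : ∀ s ∈ Icc a b, ∀ t ∈ Icc a b, s < t → g s ≠ g t)
    (hadd : L'.AdditiveOn (ι ∘ g) (Icc a b)) (h0 : ∀ s ∈ Icc a b, L'.τ (ι (g s)) (ι (g s)) = 0)
    (hσ : L.IsCausalFromTo σ c d (g a) (g b)) : L.length σ c d ≤ L.length g a b := by
  obtain ⟨hcd, hσc, hσa, hσb⟩ := hσ
  -- The embedding preserves lengths but need not preserve `τ`, so `σ` is first bounded by the time
  -- separation of `Y`. That number splits additively along each partition of `g`; every summand is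
  -- the length of a piece of `g`, which can be measured in `X` and is at most the `τ` of `X`.
  have h1 : L.length σ c d ≤ L'.τ (ι (g a)) (ι (g b)) := by
    refine (length_le_lengthOn σ (left_mem_Icc.2 hcd.le) (right_mem_Icc.2 hcd.le) hcd.le).trans ?_
    rw [hext.length_eq σ _ hσc, ← hσa, ← hσb]
    exact ((hext.causal_iff σ _ ordConnected_Icc).1 hσc).causallyMonotoneOn.lengthOn_Icc_le
  refine h1.trans (le_iInf fun N => le_iInf fun t => le_iInf fun ht => ?_)
  obtain ⟨hmem, hsum⟩ := sum_partition_eq (f := fun s t => L'.τ (ι (g s)) (ι (g t)))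
    (h0 a (left_mem_Icc.2 hab.le)) hadd ht.1 ht.2.1 ht.2.2
  rw [← hsum]
  refine Finset.sum_le_sum fun i hi => ?_
  have hi := Finset.mem_range.1 hi
  have hti := ht.2.2 i hi
  have hl := left_mem_Icc.2 hti.le
  have hr := right_mem_Icc.2 hti.le
  have hI : Icc (t i) (t (i + 1)) ⊆ Icc a b :=
    Icc_subset_Icc (hmem i hi.le).1 (hmem (i + 1) hi).2
  have hgi : L.IsCausalCurve g (Icc (t i) (t (i + 1))) := hg.mono hI ordConnected_Icc
    ⟨_, hl, _, hr, hne _ (hI hl) _ (hI hr) hti⟩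
  calc L'.τ (ι (g (t i))) (ι (g (t (i + 1))))
      = L'.length (ι ∘ g) (t i) (t (i + 1)) := ((hadd.mono hI).length_eq hti (h0 _ (hI hl))).symm
    _ ≤ L'.lengthOn (ι ∘ g) (Icc (t i) (t (i + 1))) := length_le_lengthOn _ hl hr hti.le
    _ = L.lengthOn g (Icc (t i) (t (i + 1))) := (hext.length_eq g _ hgi).symm
    _ ≤ L.τ (g (t i)) (g (t (i + 1))) := hgi.causallyMonotoneOn.lengthOn_Icc_le

/-- A point of an interval has arbitrarily small compact interval neighbourhoods. -/
theorem exists_Icc_mem_nhdsWithin {I : Set ℝ} (hI : I.OrdConnected) (hnt : I.Nontrivial) {t₀ : ℝ}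
    (ht₀ : t₀ ∈ I) {W : Set ℝ} (hW : W ∈ 𝓝[I] t₀) :
    ∃ c ∈ I, ∃ d ∈ I, c < d ∧ t₀ ∈ Icc c d ∧ Icc c d ∈ 𝓝[I] t₀ ∧ Icc c d ⊆ W := by
  obtain ⟨δ, hδ, hball⟩ := Metric.mem_nhdsWithin_iff.1 hW
  have hleft : ∃ c ∈ I, c ≤ t₀ ∧ t₀ - δ < c ∧ Ici c ∈ 𝓝[I] t₀ ∧ (c < t₀ ∨ ∀ s ∈ I, t₀ ≤ s) := by
    by_cases h : ∃ s ∈ I, s < t₀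
    · obtain ⟨s, hs, hst⟩ := h
      have hlt : max s (t₀ - δ / 2) < t₀ := max_lt hst (by linarith)
      exact ⟨max s (t₀ - δ / 2), hI.out hs ht₀ ⟨le_max_left _ _, hlt.le⟩, hlt.le,
        lt_of_lt_of_le (by linarith) (le_max_right _ _),
        mem_nhdsWithin_of_mem_nhds (Ici_mem_nhds hlt), Or.inl hlt⟩
    · push Not at h
      exact ⟨t₀, ht₀, le_rfl, by linarith, mem_of_superset self_mem_nhdsWithin h, Or.inr h⟩
  have hright : ∃ d ∈ I, t₀ ≤ d ∧ d < t₀ + δ ∧ Iic d ∈ 𝓝[I] t₀ ∧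
      (t₀ < d ∨ ∀ s ∈ I, s ≤ t₀) := by
    by_cases h : ∃ s ∈ I, t₀ < s
    · obtain ⟨s, hs, hst⟩ := h
      have hlt : t₀ < min s (t₀ + δ / 2) := lt_min hst (by linarith)
      exact ⟨min s (t₀ + δ / 2), hI.out ht₀ hs ⟨hlt.le, min_le_left _ _⟩, hlt.le,
        lt_of_le_of_lt (min_le_right _ _) (by linarith),
        mem_nhdsWithin_of_mem_nhds (Iic_mem_nhds hlt), Or.inl hlt⟩
    · push Not at h
      exact ⟨t₀, ht₀, le_rfl, by linarith, mem_of_superset self_mem_nhdsWithin h, Or.inr h⟩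
  obtain ⟨c, hc, hct, hcδ, hcn, hc'⟩ := hleft
  obtain ⟨d, hd, htd, hdδ, hdn, hd'⟩ := hright
  refine ⟨c, hc, d, hd, ?_, ⟨hct, htd⟩, inter_mem hcn hdn, fun s hs => hball ⟨?_, ?_⟩⟩
  · rcases hc' with hc' | hc'
    · exact hc'.trans_le htd
    rcases hd' with hd' | hd'
    · exact hct.trans_lt hd'
    obtain ⟨x, hx, y, hy, hxy⟩ := hnt
    exact absurd ((hd' x hx).antisymm (hc' x hx)) fun h =>
      hxy (h.trans ((hd' y hy).antisymm (hc' y hy)).symm)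
  · rw [Metric.mem_ball, Real.dist_eq, abs_lt]
    constructor <;> linarith [hs.1, hs.2]
  · exact hI.out hc hd hs

/-- The part in `X` of a maximal timelike curve of an extension is a timelike geodesic of `X` of
finite length. -/
theorem IsExtension.timelike_geodesic_of_additiveOn (hL : L.IsLorentzianLengthSpace)
    (hext : IsExtension L L' ι) {γ : ℝ → Y} {ℓ : ℝ} (hγ : L'.IsTimelikeCurve γ (Icc 0 ℓ))
    (hadd : L'.AdditiveOn γ (Icc 0 ℓ)) (hfin : L'.τ (γ 0) (γ ℓ) ≠ ⊤) {I : Set ℝ}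
    (hI : I.OrdConnected) (hIℓ : I ⊆ Icc 0 ℓ) (hnt : I.Nontrivial) {g : ℝ → X}
    (hg : ∀ t ∈ I, ι (g t) = γ t) :
    L.IsTimelikeCurve g I ∧ L.IsGeodesic g I ∧ L.lengthOn g I ≠ ⊤ := by
  have hinj := hext.isometry.injective
  have hm := hγ.isCausalCurve.causallyMonotoneOn
  have hτ : ∀ s ∈ Icc 0 ℓ, ∀ t ∈ Icc 0 ℓ, s ≤ t → L'.τ (γ s) (γ t) ≤ L'.τ (γ 0) (γ ℓ) := by
    intro s hs t ht hst
    have hℓ : 0 ≤ ℓ := hs.1.trans hs.2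
    exact τ_mono (hm _ (left_mem_Icc.2 hℓ) s hs hs.1) (hm s hs t ht hst)
      (hm t ht _ (right_mem_Icc.2 hℓ) ht.2)
  have hself : ∀ s ∈ Icc 0 ℓ, L'.τ (γ s) (γ s) ≠ ⊤ := fun s hs =>
    ne_top_of_le_ne_top hfin (hτ s hs s hs le_rfl)
  have hne : ∀ s ∈ I, ∀ t ∈ I, s < t → g s ≠ g t := by
    intro s hs t ht hst h
    have h1 := hγ.2.2.2 s (hIℓ hs) t (hIℓ ht) hst
    have h2 : γ s = γ t := by rw [← hg s hs, ← hg t ht, h]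
    rw [h2] at h1
    exact ll_irrefl (hself t (hIℓ ht)) h1
  have hexne : ∃ s ∈ I, ∃ t ∈ I, g s ≠ g t := by
    obtain ⟨s, hs, t, ht, hst⟩ := hnt
    rcases lt_or_gt_of_ne hst with h | h
    · exact ⟨s, hs, t, ht, hne s hs t ht h⟩
    · exact ⟨t, ht, s, hs, hne t ht s hs h⟩
  have htl : L'.IsTimelikeCurve (ι ∘ g) I := by
    refine ⟨hI, ?_, ?_, fun s hs t ht hst => ?_⟩
    · intro s hs
      obtain ⟨K, W, hW, hKW⟩ := hγ.2.1.mono hIℓ hs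
      refine ⟨K, W ∩ I, inter_mem hW self_mem_nhdsWithin, fun u hu v hv => ?_⟩
      have := hKW hu.1 hv.1
      rwa [← hg u hu.2, ← hg v hv.2] at this
    · obtain ⟨s, hs, t, ht, hst⟩ := hexne
      exact ⟨s, hs, t, ht, fun h => hst (hinj h)⟩
    · rw [Function.comp_apply, Function.comp_apply, hg s hs, hg t ht]
      exact hγ.2.2.2 s (hIℓ hs) t (hIℓ ht) hst
  have htg : L.IsTimelikeCurve g I := (hext.timelike_iff g I hI).2 htl
  refine ⟨htg, ⟨htg.isCausalCurve, fun t₀ ht₀ => ?_⟩, ?_⟩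
  · obtain ⟨Ω, hΩ⟩ := hL.localisable (g t₀)
    obtain ⟨c, hc, d, hd, hcd, ht₀cd, hnhd, hsub⟩ := exists_Icc_mem_nhdsWithin hI hnt ht₀
      (htg.2.1.continuousOn t₀ ht₀ (hΩ.1.mem_nhds hΩ.2.1))
    have hcdI : Icc c d ⊆ I := hI.out hc hd
    have hgcd : L.IsCausalCurve g (Icc c d) := htg.isCausalCurve.mono hcdI ordConnected_Icc
      ⟨c, left_mem_Icc.2 hcd.le, d, right_mem_Icc.2 hcd.le, hne c hc d hd hcd⟩
    -- The curve is maximal among all causal curves of `X` with its endpoints, so any localising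
    -- neighbourhood containing the segment will do.
    refine ⟨Ω, hΩ, c, hc, d, hd, ht₀cd, hnhd, hcd, hgcd, image_subset_iff.2 hsub,
      fun σ c' d' hσ _ => hext.length_le_of_additiveOn hcd hgcd
        (fun s hs t ht => hne s (hcdI hs) t (hcdI ht)) ?_ (fun s hs => ?_) hσ⟩
    · intro s hs r hr t ht hsr hrt
      simp only [Function.comp_apply]
      rw [hg s (hcdI hs), hg r (hcdI hr), hg t (hcdI ht)]
      exact hadd s (hIℓ (hcdI hs)) r (hIℓ (hcdI hr)) t (hIℓ (hcdI ht)) hsr hrt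
    · rw [hg s (hcdI hs)]
      exact τ_self_eq_zero (hself s (hIℓ (hcdI hs)))
  · rw [hext.length_eq g I htg.isCausalCurve]
    refine ne_top_of_le_ne_top hfin (lengthOn_le fun s hs t ht hst => ?_)
    rw [Function.comp_apply, Function.comp_apply, hg s hs, hg t ht]
    exact hτ s (hIℓ hs) t (hIℓ ht) hst

/-- A maximal timelike curve of an extension cannot leave `X` to the future. -/
theorem IsExtension.mem_range_of_left_mem_range (hL : L.IsLorentzianLengthSpace)
    (hTC : L.PropertyTC) (hext : IsExtension L L' ι) {γ : ℝ → Y} {ℓ : ℝ} (hℓ : 0 < ℓ)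
    (hγ : L'.IsTimelikeCurve γ (Icc 0 ℓ)) (hadd : L'.AdditiveOn γ (Icc 0 ℓ))
    (hfin : L'.τ (γ 0) (γ ℓ) ≠ ⊤) (h0 : γ 0 ∈ range ι) : γ ℓ ∈ range ι := by
  by_contra hout
  have hcont := hγ.2.1.continuousOn
  have hclosed : IsClosed (Icc 0 ℓ ∩ γ ⁻¹' (range ι)ᶜ) :=
    hcont.preimage_isClosed_of_isClosed isClosed_Icc hext.isOpen_range.isClosed_compl
  -- `T` is the first exit time; on `[0, T)` the curve lifts to a geodesic of `X` of finite length,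
  -- to which (TC) applies.
  obtain ⟨T, ⟨hT, hTout⟩, hTmin⟩ := (isCompact_Icc.of_isClosed_subset hclosed
    inter_subset_left).exists_isLeast ⟨ℓ, right_mem_Icc.2 hℓ.le, hout⟩
  have hTpos : 0 < T := hT.1.lt_of_ne fun h => hTout (h ▸ h0)
  have hIℓ : Ico 0 T ⊆ Icc 0 ℓ := fun t ht => ⟨ht.1, ht.2.le.trans hT.2⟩
  have hin : ∀ t ∈ Ico 0 T, ∃ x, ι x = γ t := fun t ht => by
    by_contra hcon
    exact ht.2.not_ge (hTmin ⟨hIℓ ht, hcon⟩)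
  have : Nonempty X := ⟨h0.choose⟩
  choose! g hg using hin
  obtain ⟨htl, hgeo, hlen⟩ := hext.timelike_geodesic_of_additiveOn hL hγ hadd hfin ordConnected_Ico
    hIℓ ⟨0, ⟨le_rfl, hTpos⟩, T / 2, ⟨by linarith, by linarith⟩, by linarith⟩ hg
  refine hlen (hTC.1 g 0 T hTpos htl hgeo ?_)
  rintro ⟨φ, σ, ⟨hφc, hφm, hφ0, hφT⟩, hσ, heq⟩
  have hl := left_mem_Icc.2 hTpos.le
  have hr := right_mem_Icc.2 hTpos.le
  have hmaps : MapsTo φ (Icc 0 T) (Icc 0 T) := fun t ht =>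
    ⟨hφ0 ▸ hφm.monotoneOn hl ht ht.1, hφT ▸ hφm.monotoneOn ht hr ht.2⟩
  have hnhd : Icc 0 T ∈ 𝓝[<] T := Icc_mem_nhdsLT hTpos
  -- The extended geodesic ends at `σ T` in `X`. Since `φ` fixes `T`, both limits describe the same
  -- point, and `γ T = ι (σ T)` lies in the image.
  have h1 : Tendsto (fun t => ι (σ t)) (𝓝[<] T) (𝓝 (ι (σ T))) :=
    (hext.isometry.continuous.tendsto _).comp
      ((hσ.1.2.1.continuousOn T hr).mono_of_mem_nhdsWithin hnhd).tendsto
  have h2 : Tendsto (fun t => γ (φ t)) (𝓝[<] T) (𝓝 (γ T)) := by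
    have : ContinuousOn (γ ∘ φ) (Icc 0 T) :=
      (hcont.mono (Icc_subset_Icc_right hT.2)).comp hφc hmaps
    have := ((this T hr).mono_of_mem_nhdsWithin hnhd).tendsto
    rwa [Function.comp_apply, hφT] at this
  refine hTout ⟨σ T, tendsto_nhds_unique (h1.congr' ?_) h2⟩
  filter_upwards [Ico_mem_nhdsLT hTpos] with t ht
  have hφt : φ t ∈ Ico 0 T :=
    ⟨(hmaps (Ico_subset_Icc_self ht)).1, hφT ▸ hφm (Ico_subset_Icc_self ht) hr ht.2⟩
  rw [heq t ht, hg _ hφt]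

/-- A maximal timelike curve of an extension cannot leave `X` to the past. -/
theorem IsExtension.mem_range_of_right_mem_range (hL : L.IsLorentzianLengthSpace)
    (hTC : L.PropertyTC) (hext : IsExtension L L' ι) {γ : ℝ → Y} {ℓ : ℝ} (hℓ : 0 < ℓ)
    (hγ : L'.IsTimelikeCurve γ (Icc 0 ℓ)) (hadd : L'.AdditiveOn γ (Icc 0 ℓ))
    (hfin : L'.τ (γ 0) (γ ℓ) ≠ ⊤) (h0 : γ ℓ ∈ range ι) : γ 0 ∈ range ι := by
  by_contra hout
  have hcont := hγ.2.1.continuousOn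
  have hclosed : IsClosed (Icc 0 ℓ ∩ γ ⁻¹' (range ι)ᶜ) :=
    hcont.preimage_isClosed_of_isClosed isClosed_Icc hext.isOpen_range.isClosed_compl
  obtain ⟨T, ⟨hT, hTout⟩, hTmax⟩ := (isCompact_Icc.of_isClosed_subset hclosed
    inter_subset_left).exists_isGreatest ⟨0, left_mem_Icc.2 hℓ.le, hout⟩
  have hTlt : T < ℓ := hT.2.lt_of_ne fun h => hTout (h ▸ h0)
  have hIℓ : Ioc T ℓ ⊆ Icc 0 ℓ := fun t ht => ⟨hT.1.trans ht.1.le, ht.2⟩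
  have hin : ∀ t ∈ Ioc T ℓ, ∃ x, ι x = γ t := fun t ht => by
    by_contra hcon
    exact ht.1.not_ge (hTmax ⟨hIℓ ht, hcon⟩)
  have : Nonempty X := ⟨h0.choose⟩
  choose! g hg using hin
  obtain ⟨htl, hgeo, hlen⟩ := hext.timelike_geodesic_of_additiveOn hL hγ hadd hfin ordConnected_Ioc
    hIℓ ⟨ℓ, ⟨hTlt, le_rfl⟩, (T + ℓ) / 2, ⟨by linarith, by linarith⟩, by linarith⟩ hg
  refine hlen (hTC.2 g T ℓ hTlt htl hgeo ?_)
  rintro ⟨φ, σ, ⟨hφc, hφm, hφT, hφℓ⟩, hσ, heq⟩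
  have hl := left_mem_Icc.2 hTlt.le
  have hr := right_mem_Icc.2 hTlt.le
  have hmaps : MapsTo φ (Icc T ℓ) (Icc T ℓ) := fun t ht =>
    ⟨hφT.symm.trans_le (hφm.monotoneOn hl ht ht.1), (hφm.monotoneOn ht hr ht.2).trans_eq hφℓ⟩
  have hnhd : Icc T ℓ ∈ 𝓝[>] T := Icc_mem_nhdsGT hTlt
  have h1 : Tendsto (fun t => ι (σ t)) (𝓝[>] T) (𝓝 (ι (σ T))) :=
    (hext.isometry.continuous.tendsto _).comp
      ((hσ.1.2.1.continuousOn T hl).mono_of_mem_nhdsWithin hnhd).tendsto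
  have h2 : Tendsto (fun t => γ (φ t)) (𝓝[>] T) (𝓝 (γ T)) := by
    have : ContinuousOn (γ ∘ φ) (Icc T ℓ) :=
      (hcont.mono (Icc_subset_Icc_left hT.1)).comp hφc hmaps
    have := ((this T hl).mono_of_mem_nhdsWithin hnhd).tendsto
    rwa [Function.comp_apply, hφT] at this
  refine hTout ⟨σ T, tendsto_nhds_unique (h1.congr' ?_) h2⟩
  filter_upwards [Ioc_mem_nhdsGT hTlt] with t ht
  have hφt : φ t ∈ Ioc T ℓ :=
    ⟨hφT.symm.trans_lt (hφm hl (Ioc_subset_Icc_self ht) ht.1), (hmaps (Ioc_subset_Icc_self ht)).2⟩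
  rw [heq t ht, hg _ hφt]

/-! ### Boundary points of an open set that are reached by timelike curves -/

/-- At the first exit time the curve itself supplies points of `V` in the chronological past that
converge to the exit point. -/
theorem IsTimelikeCurve.exists_exit_point {V : Set X} (hV : IsOpen V) {σ : ℝ → X} {a b : ℝ}
    (hab : a < b) (hσ : L.IsTimelikeCurve σ (Icc a b)) (ha : σ a ∈ V) (hb : σ b ∉ V) :
    ∃ p ∉ V, ∃ᶠ x in 𝓝 p, x ∈ V ∧ L.ll x p := by
  have hcont := hσ.2.1.continuousOn
  have hclosed : IsClosed (Icc a b ∩ σ ⁻¹' Vᶜ) :=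
    hcont.preimage_isClosed_of_isClosed isClosed_Icc hV.isClosed_compl
  obtain ⟨T, ⟨hT, hTout⟩, hTmin⟩ := (isCompact_Icc.of_isClosed_subset hclosed
    inter_subset_left).exists_isLeast ⟨b, right_mem_Icc.2 hab.le, hb⟩
  have hTpos : a < T := hT.1.lt_of_ne fun h => hTout (h ▸ ha)
  refine ⟨σ T, hTout, ?_⟩
  have htend : Tendsto σ (𝓝[<] T) (𝓝 (σ T)) :=
    ((hcont T hT).mono_of_mem_nhdsWithin
      (mem_of_superset (Icc_mem_nhdsLT hTpos) (Icc_subset_Icc_right hT.2))).tendsto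
  refine htend.frequently (Eventually.frequently ?_)
  filter_upwards [Ico_mem_nhdsLT hTpos] with t ht
  have ht' : t ∈ Icc a b := ⟨ht.1, ht.2.le.trans hT.2⟩
  refine ⟨?_, hσ.2.2.2 t ht' T hT ht.2⟩
  by_contra hcon
  exact ht.2.not_ge (hTmin ⟨ht', hcon⟩)

theorem IsTimelikeCurve.exists_entry_point {V : Set X} (hV : IsOpen V) {σ : ℝ → X} {a b : ℝ}
    (hab : a < b) (hσ : L.IsTimelikeCurve σ (Icc a b)) (ha : σ a ∉ V) (hb : σ b ∈ V) :
    ∃ p ∉ V, ∃ᶠ x in 𝓝 p, x ∈ V ∧ L.ll p x := by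
  have hcont := hσ.2.1.continuousOn
  have hclosed : IsClosed (Icc a b ∩ σ ⁻¹' Vᶜ) :=
    hcont.preimage_isClosed_of_isClosed isClosed_Icc hV.isClosed_compl
  obtain ⟨T, ⟨hT, hTout⟩, hTmax⟩ := (isCompact_Icc.of_isClosed_subset hclosed
    inter_subset_left).exists_isGreatest ⟨a, left_mem_Icc.2 hab.le, ha⟩
  have hTlt : T < b := hT.2.lt_of_ne fun h => hTout (h ▸ hb)
  refine ⟨σ T, hTout, ?_⟩
  have htend : Tendsto σ (𝓝[>] T) (𝓝 (σ T)) :=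
    ((hcont T hT).mono_of_mem_nhdsWithin
      (mem_of_superset (Icc_mem_nhdsGT hTlt) (Icc_subset_Icc_left hT.1))).tendsto
  refine htend.frequently (Eventually.frequently ?_)
  filter_upwards [Ioc_mem_nhdsGT hTlt] with t ht
  have ht' : t ∈ Icc a b := ⟨hT.1.trans ht.1.le, ht.2⟩
  refine ⟨?_, hσ.2.2.2 T hT t ht' ht.1⟩
  by_contra hcon
  exact ht.1.not_ge (hTmax ⟨ht', hcon⟩)

/-- The boundary of a nontrivial open set of a connected Lorentzian length space is reached from
inside by a timelike curve. -/
theorem IsLorentzianLengthSpace.exists_timelike_boundary_point [ConnectedSpace X]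
    (hL : L.IsLorentzianLengthSpace) {V : Set X} (hV : IsOpen V) (hne : V.Nonempty)
    (huniv : V ≠ univ) :
    ∃ p ∉ V, (∃ᶠ x in 𝓝 p, x ∈ V ∧ L.ll x p) ∨ (∃ᶠ x in 𝓝 p, x ∈ V ∧ L.ll p x) := by
  have hout : ∀ x ∈ V, ∀ y ∉ V, L.ll x y → ∃ p ∉ V, (∃ᶠ x in 𝓝 p, x ∈ V ∧ L.ll x p) ∨
      (∃ᶠ x in 𝓝 p, x ∈ V ∧ L.ll p x) := by
    intro x hx y hy hxy
    obtain ⟨σ, a, b, hab, hσ, rfl, rfl⟩ := hL.causallyPathConnected.1 x y hxy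
    obtain ⟨p, hp, h⟩ := hσ.exists_exit_point hV hab hx hy
    exact ⟨p, hp, Or.inl h⟩
  obtain ⟨p, hp⟩ : (frontier V).Nonempty := by
    rw [nonempty_iff_ne_empty]
    intro h
    rcases isClopen_iff.1 (isClopen_iff_frontier_eq_empty.2 h) with h | h
    · exact hne.ne_empty h
    · exact huniv h
  rw [hV.frontier_eq] at hp
  obtain ⟨Ω, hΩ⟩ := hL.localisable p
  -- Take `q` in the future of the frontier point `p`. If `q ∈ V`, a timelike curve from `p` to `q`
  -- enters `V`. Otherwise the open set `I⁻(q)` contains `p` and so meets `V`, and a timelike curve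
  -- from there to `q` leaves `V`.
  obtain ⟨q, -, hpq⟩ := (hΩ.2.2.2.1 p hΩ.2.1).1
  by_cases hq : q ∈ V
  · obtain ⟨σ, a, b, hab, hσ, rfl, rfl⟩ := hL.causallyPathConnected.1 p q hpq
    obtain ⟨p', hp', h⟩ := hσ.exists_entry_point hV hab hp.2 hq
    exact ⟨p', hp', Or.inr h⟩
  · obtain ⟨r, hrq, hrV⟩ := mem_closure_iff.1 hp.1 _ (isOpen_chronologicalPast q) hpq
    exact hout r hrV q hq hrq

/-- Extensions of Lorentzian length spaces with property (TC) have points without comparison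
neighbourhoods for upper causal curvature bounds. -/
theorem IsExtension.causalCurvatureUnboundedAbove [Nonempty X] (hL : L.IsLorentzianLengthSpace)
    (hTC : L.PropertyTC) (hL' : L'.IsLorentzianLengthSpace) (hext : IsExtension L L' ι) :
    L'.CausalCurvatureUnboundedAbove := by
  have := hext.connected
  obtain ⟨p, hp, h⟩ := hL'.exists_timelike_boundary_point hext.isOpen_range (range_nonempty ι)
    hext.range_ne_univ
  refine ⟨p, fun K U hU => hp ?_⟩
  rcases h with h | h
  · obtain ⟨x, ⟨hxV, hxp⟩, hx⟩ := (h.and_eventually (hU.exists_timelikeMaximiser_to hL')).exists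
    obtain ⟨γ, a, b, hγ, rfl, rfl⟩ := hx hxp
    obtain ⟨σ, ℓ, hℓ, hσ, hadd, h0, h1⟩ := hγ.exists_timelikeCurve
    rw [← h1]
    exact hext.mem_range_of_left_mem_range hL hTC hℓ hσ hadd
      (by rw [h0, h1]; exact hγ.finite) (by rwa [h0])
  · obtain ⟨x, ⟨hxV, hpx⟩, hx⟩ := (h.and_eventually (hU.exists_timelikeMaximiser_from hL')).exists
    obtain ⟨γ, a, b, hγ, rfl, rfl⟩ := hx hpx
    obtain ⟨σ, ℓ, hℓ, hσ, hadd, h0, h1⟩ := hγ.exists_timelikeCurve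
    rw [← h0]
    exact hext.mem_range_of_right_mem_range hL hTC hℓ hσ hadd
      (by rw [h0, h1]; exact hγ.finite) (by rwa [h1])

end LorentzianPreLength

end

theorem theorem5p4 {X Y : Type*} [MetricSpace X] [Nonempty X] [MetricSpace Y]
    (L : LorentzianPreLength X) (hL : L.IsLorentzianLengthSpace)
    (hsc : L.StronglyCausal) (hTC : L.PropertyTC)
    (L' : LorentzianPreLength Y) (hL' : L'.IsLorentzianLengthSpace)
    (ι : X → Y) (hext : LorentzianPreLength.IsExtension L L' ι) :
    L'.HasCausalCurvatureSingularity ∧ L'.CausalCurvatureUnboundedAbove ∧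
      ∀ K : ℝ, ¬ L'.CausalCurvatureBoundedAbove K := by
  have h := hext.causalCurvatureUnboundedAbove hL hTC hL'
  refine ⟨Or.inl h, h, fun K hK => ?_⟩
  obtain ⟨x, hx⟩ := h
  obtain ⟨U, hU⟩ := hK x
  exact hx K U hU
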